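/- For covariance matrices (symmetric positive semidefinite matrices) $\Sigma\in\mathbb R^{d\times d}$ let $X_1,X_2,\dots$ be i.i.d. $\mathcal N(0,\Sigma)$ in $\mathbb R^d$, let $\widehat\Sigma_N=\frac1N\sum_{i=1}^N X_iX_i^\top$, and let $\|P-Q\|_{TV}=\frac12\int|dP-dQ|$. A class $\mathcal P$ of probability distributions on $\mathcal X$ admits an $(n,n+m,\varepsilon)$ sample amplification procedure if there is a Markov kernel (randomized map) $T$ from $\mathcal X^n$ to $\mathcal X^{n+m}$ such that $\|P^{\otimes n}\circ T^{-1}-P^{\otimes(n+m)}\|_{TV}\le\varepsilon$ for every $P\in\mathcal P$. Put $\mathcal P_d=\{\mathcal N(0,\Sigma):\Sigma\in\mathbb R^{d\times d}\text{ a covariance matrix}\}$. The uniform distribution on the Stiefel set $A=\{U\in\mathbb R^{d\times N}:UU^\top=I_d\}$ is the unique probability measure on $A$ that is invariant under $U\mapsto UV$ for all orthogonal $V\in\mathbb R^{N\times N}$. Let $d,n,m$ be natural numbers with $n\ge 4\max\{m,d\}$. Then: (1) For every covariance matrix $\Sigma$, $\ \|\mathcal L(\widehat\Sigma_n)-\mathcal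 L(\widehat\Sigma_{n+m})\|_{TV}\le \dfrac{2md}{n}$. (2) $\mathcal P_d$ admits an $(n,n+m,2md/n)$ sample amplification procedure. (3) For every positive definite $\Sigma$, the normalized data matrix $S_{n+m}=[(n+m)\widehat\Sigma_{n+m}]^{-1/2}[X_1,\dots,X_{n+m}]\in\mathbb R^{d\times(n+m)}$ (almost surely well defined) is uniformly distributed on $A=\{U\in\mathbb R^{d\times(n+m)}:UU^\top=I_d\}$. For an arbitrary, possibly singular, covariance matrix $\Sigma$ there is a version of $S_{n+m}$, that is, a random matrix $S$ (possibly using randomness beyond the data) with $SS^\top=I_d$ and $[(n+m)\widehat\Sigma_{n+m}]^{1/2}S=[X_1,\dots,X_{n+m}]$ almost surely, that is uniformly distributed on $A$. In consequence, $(n,n+\Omega(n/d))$ amplification is possible: for every $\varepsilon>0$ there is a constant $c>0$, depending only on $\varepsilon$, such that for all $d\ge1$, all $n$ and all $m\le c\,n/d$ the class $\mathcal P_d$ admits an $(n,n+m,\varepsilon)$ sample amplification procedure. -/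

import Mathlib

open MeasureTheory ProbabilityTheory
open scoped MatrixOrder

noncomputable section

/-- Matrices carry the product (equivalently, Borel) sigma-algebra of their entries. -/
instance instMeasurableSpaceRealMatrix {d N : ℕ} : MeasurableSpace (Matrix (Fin d) (Fin N) ℝ) :=
  inferInstanceAs (MeasurableSpace (Fin d → Fin N → ℝ))

instance instBorelSpaceRealMatrix {d N : ℕ} : BorelSpace (Matrix (Fin d) (Fin N) ℝ) :=
  inferInstanceAs (BorelSpace (Fin d → Fin N → ℝ))

/-- Total variation distance `½ ∫ |dP - dQ|`, with the densities taken with respect to the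
dominating measure `P + Q`. -/
def tvDist {α : Type*} [MeasurableSpace α] (P Q : Measure α) : ℝ :=
  (1 / 2) * ∫ x, |(P.rnDeriv (P + Q) x).toReal - (Q.rnDeriv (P + Q) x).toReal| ∂(P + Q)

/-- A class `Model` of probability distributions admits an `(n, n + m, ε)` sample amplification
procedure: some randomized map (Markov kernel) from `n`-tuples to `(n + m)`-tuples, not depending on
the unknown `P ∈ Model`, sends `P^{⊗ n}` to within total variation distance `ε` of `P^{⊗ (n + m)}`. -/
def AdmitsSampleAmplification {𝒳 : Type*} [MeasurableSpace 𝒳]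
    (Model : Set (ProbabilityMeasure 𝒳)) (n m : ℕ) (ε : ℝ) : Prop :=
  ∃ T : Kernel (Fin n → 𝒳) (Fin (n + m) → 𝒳), IsMarkovKernel T ∧
    ∀ P ∈ Model,
      tvDist ((Measure.pi (fun _ : Fin n => (P : Measure 𝒳))).bind T)
        (Measure.pi (fun _ : Fin (n + m) => (P : Measure 𝒳))) ≤ ε

/-- The centered Gaussian model `{N(0, Σ) : Σ a covariance matrix}` on `ℝ^d`. -/
def gaussianCovarianceModel (d : ℕ) : Set (ProbabilityMeasure (EuclideanSpace ℝ (Fin d))) :=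
  {P | ∃ C : Matrix (Fin d) (Fin d) ℝ, C.PosSemidef ∧
    (P : Measure (EuclideanSpace ℝ (Fin d))) = multivariateGaussian 0 C}

/-- The joint law of `N` i.i.d. observations `X₁, …, X_N` from `N(0, C)`. -/
def gaussianSample {d : ℕ} (C : Matrix (Fin d) (Fin d) ℝ) (N : ℕ) :
    Measure (Fin N → EuclideanSpace ℝ (Fin d)) :=
  Measure.pi (fun _ : Fin N => multivariateGaussian 0 C)

/-- The data matrix `[X₁, …, X_N] ∈ ℝ^{d × N}`. -/
def dataMatrix {d N : ℕ} (x : Fin N → EuclideanSpace ℝ (Fin d)) : Matrix (Fin d) (Fin N) ℝ :=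
  Matrix.of fun i j => x j i

/-- The sample covariance `N⁻¹ ∑ᵢ Xᵢ Xᵢᵀ` (known zero mean). -/
def sampleCov {d N : ℕ} (x : Fin N → EuclideanSpace ℝ (Fin d)) : Matrix (Fin d) (Fin d) ℝ :=
  (N : ℝ)⁻¹ • ∑ j, Matrix.vecMulVec (x j).ofLp (x j).ofLp

/-- The normalized data matrix `[N Σ̂_N]^{-1/2} [X₁, …, X_N]`. -/
def normalizedData {d N : ℕ} (x : Fin N → EuclideanSpace ℝ (Fin d)) :
    Matrix (Fin d) (Fin N) ℝ :=
  (CFC.sqrt ((N : ℝ) • sampleCov x))⁻¹ * dataMatrix x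

/-- The Stiefel set `{U ∈ ℝ^{d × N} : U Uᵀ = I_d}`. -/
def stiefel (d N : ℕ) : Set (Matrix (Fin d) (Fin N) ℝ) :=
  {U | U * U.transpose = 1}

/-- `μ` is a probability measure carried by the Stiefel set and invariant under the action
`U ↦ U V` of the orthogonal group `O(N)`. -/
structure IsInvariantOnStiefel {d N : ℕ} (μ : Measure (Matrix (Fin d) (Fin N) ℝ)) : Prop where
  isProbabilityMeasure : IsProbabilityMeasure μ
  measure_compl : μ (stiefel d N)ᶜ = 0
  invariant : ∀ V ∈ Matrix.orthogonalGroup (Fin N) ℝ, μ.map (fun U => U * V) = μ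

/-- `μ` is the uniform distribution on the Stiefel set: the one and only probability measure on it
that is invariant under the transitive action of `O(N)`. -/
def IsUniformOnStiefel {d N : ℕ} (μ : Measure (Matrix (Fin d) (Fin N) ℝ)) : Prop :=
  IsInvariantOnStiefel μ ∧
    ∀ ν : Measure (Matrix (Fin d) (Fin N) ℝ), IsInvariantOnStiefel ν → ν = μ

/-- A (possibly randomized) version of the normalized data matrix, carried by the Stiefel set: given
the data `x`, a random `U` with law `κ x` that satisfies `U Uᵀ = I_d` and
`[N Σ̂_N]^{1/2} U = [X₁, …, X_N]` almost surely. When `Σ̂_N` is invertible, the second equation says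
that `U` is the normalized data matrix. -/
structure IsNormalizedDataVersion {d N : ℕ} (C : Matrix (Fin d) (Fin d) ℝ)
    (κ : Kernel (Fin N → EuclideanSpace ℝ (Fin d)) (Matrix (Fin d) (Fin N) ℝ)) : Prop where
  isMarkovKernel : IsMarkovKernel κ
  ae_mem : ∀ᵐ x ∂(gaussianSample C N), ∀ᵐ U ∂(κ x), U ∈ stiefel d N
  ae_eq : ∀ᵐ x ∂(gaussianSample C N), ∀ᵐ U ∂(κ x),
    CFC.sqrt ((N : ℝ) • sampleCov x) * U = dataMatrix x

/-- The sample covariance is a measurable statistic. -/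
theorem measurable_sampleCov {d N : ℕ} :
    Measurable (sampleCov : (Fin N → EuclideanSpace ℝ (Fin d)) → Matrix (Fin d) (Fin d) ℝ) := by
  refine measurable_pi_iff.2 fun a => measurable_pi_iff.2 fun b => ?_
  simp only [sampleCov, Matrix.smul_apply, Matrix.sum_apply, Matrix.vecMulVec_apply]
  fun_prop

end

/-! The centered Gaussian sample law is invariant under right multiplication of the data matrix by
`O(N)`. Hence, if `X = (X Xᵀ)^{1/2} U` is a polar decomposition and `V` is Haar distributed, then
`(X Xᵀ)^{1/2} U V` has the law of `X`, while `U V` is a random frame whose law does not depend on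
`X`. So the sample is regenerated from its sample covariance and an independent uniform frame
(`map_reconstruct`). The amplifier computes `Σ̂ₙ`, treats it as `Σ̂ₙ₊ₘ`, and attaches a fresh frame.
By data processing its error is at most the distance between the laws of the two sample covariances,
and these are images of the laws for `Σ = I` under a common map.

For `Σ = I` put `s = (n+m)/n` and let `W_N` be the scatter matrix of `N` observations. The law of
`s⁻¹ W_{n+m}` has density proportional to `det^{m/2} exp(-(s-1)/2 · tr)` with respect to the law of
`W_n`. This follows from Laplace transforms (`map_scatter_withDensity`), without the Wishart
density. Total variation is bounded by the symmetrized divergence (`tvDist_withDensity_le`). With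
this `s` the trace terms cancel in the divergence, and what remains is `m/2 · (E log det W_{n+m} - E
log det W_n - d log s)`.

The increments of `E log det` are bounded through `log r ≤ r - 1` and the mean of `det W_{k+1} / det
W_k`. That mean is accessible because size-biasing `W_j` by its determinant produces the law of
`W_{j+2}`, so the ratio at `k = j + 2` has mean at most `E det W_{j+1} / E det W_j = (j+1)/(j+1-d)`;
the last value comes from a leave-one-out identity for determinants. Summation gives a divergence of
at most `3(md/n)²`, hence the linear bound in `md/n`.

The normalized data inherit right invariance from the sample, and invariance determines a
probability measure on the Stiefel set (`IsInvariantOnStiefel.eq_stiefelLaw`). For singular `Σ` the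
version is obtained by disintegrating the joint law of the regenerated sample and its frame. -/

open scoped ENNReal

noncomputable section

/-! ### Total variation: test functions, data processing, divergence bound. -/

section TotalVariation

variable {α β : Type*} [MeasurableSpace α] [MeasurableSpace β]

theorem integral_mul_rnDeriv_add_left (P Q : Measure α) [IsProbabilityMeasure P]
    [IsProbabilityMeasure Q] (h : α → ℝ) :
    ∫ x, (P.rnDeriv (P + Q) x).toReal * h x ∂(P + Q) = ∫ x, h x ∂P :=
  integral_rnDeriv_smul (Measure.absolutelyContinuous_of_le (Measure.le_add_right le_rfl))

theorem integral_mul_rnDeriv_add_right (P Q : Measure α) [IsProbabilityMeasure P]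
    [IsProbabilityMeasure Q] (h : α → ℝ) :
    ∫ x, (Q.rnDeriv (P + Q) x).toReal * h x ∂(P + Q) = ∫ x, h x ∂Q :=
  integral_rnDeriv_smul (Measure.absolutelyContinuous_of_le (Measure.le_add_left le_rfl))

/-- The total variation distance is attained on the set where one density exceeds the other. -/
theorem exists_tvDist_eq (P Q : Measure α) [IsProbabilityMeasure P] [IsProbabilityMeasure Q] :
    ∃ A, MeasurableSet A ∧ tvDist P Q = P.real A - Q.real A := by
  set p := fun x => (P.rnDeriv (P + Q) x).toReal with hp
  set q := fun x => (Q.rnDeriv (P + Q) x).toReal with hq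
  have mp : Measurable p := (Measure.measurable_rnDeriv _ _).ennreal_toReal
  have mq : Measurable q := (Measure.measurable_rnDeriv _ _).ennreal_toReal
  have ip : Integrable p (P + Q) := Measure.integrable_toReal_rnDeriv
  have iq : Integrable q (P + Q) := Measure.integrable_toReal_rnDeriv
  have hA : MeasurableSet {x | q x ≤ p x} := measurableSet_le mq mp
  refine ⟨{x | q x ≤ p x}, hA, ?_⟩
  have e : ∀ x, |p x - q x| = 2 * ({x | q x ≤ p x}.indicator (fun x => p x - q x) x)
      - (p x - q x) := by
    intro x
    by_cases h : q x ≤ p x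
    · rw [Set.indicator_of_mem (by exact h), abs_of_nonneg (by linarith)]; ring
    · rw [Set.indicator_of_notMem (by exact h), abs_of_neg (by linarith)]; ring
  have tp : ∫ x, p x ∂(P + Q) = 1 := by
    simpa using integral_mul_rnDeriv_add_left P Q (fun _ => 1)
  have tq : ∫ x, q x ∂(P + Q) = 1 := by
    simpa using integral_mul_rnDeriv_add_right P Q (fun _ => 1)
  have sp : ∫ x in {x | q x ≤ p x}, p x ∂(P + Q) = P.real {x | q x ≤ p x} := by
    rw [← integral_indicator hA, ← integral_indicator_one hA,
      ← integral_mul_rnDeriv_add_left P Q]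
    congr 1; ext x; by_cases h : q x ≤ p x <;> simp [Set.indicator, h, p]
  have sq : ∫ x in {x | q x ≤ p x}, q x ∂(P + Q) = Q.real {x | q x ≤ p x} := by
    rw [← integral_indicator hA, ← integral_indicator_one hA,
      ← integral_mul_rnDeriv_add_right P Q]
    congr 1; ext x; by_cases h : q x ≤ p x <;> simp [Set.indicator, h, q]
  have : tvDist P Q = 1 / 2 * ∫ x, |p x - q x| ∂(P + Q) := rfl
  rw [this]
  simp_rw [e]
  have ipq : Integrable (fun x => p x - q x) (P + Q) := ip.sub iq
  rw [integral_sub ((ipq.indicator hA).const_mul 2) ipq, integral_const_mul,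
    integral_indicator hA, integral_sub ip.integrableOn iq.integrableOn, integral_sub ip iq,
    sp, sq, tp, tq]
  ring

/-- Pointwise `h (p - q) ≤ |p - q|/2 + (p - q)/2` when `0 ≤ h ≤ 1`, and `p - q` integrates to zero.
-/
theorem integral_sub_integral_le_tvDist (P Q : Measure α) [IsProbabilityMeasure P]
    [IsProbabilityMeasure Q] {h : α → ℝ} (hm : Measurable h) (h0 : ∀ x, 0 ≤ h x)
    (h1 : ∀ x, h x ≤ 1) : ∫ x, h x ∂P - ∫ x, h x ∂Q ≤ tvDist P Q := by
  set p := fun x => (P.rnDeriv (P + Q) x).toReal with hp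
  set q := fun x => (Q.rnDeriv (P + Q) x).toReal with hq
  have ip : Integrable p (P + Q) := Measure.integrable_toReal_rnDeriv
  have iq : Integrable q (P + Q) := Measure.integrable_toReal_rnDeriv
  have tp : ∫ x, p x ∂(P + Q) = 1 := by
    simpa using integral_mul_rnDeriv_add_left P Q (fun _ => 1)
  have tq : ∫ x, q x ∂(P + Q) = 1 := by
    simpa using integral_mul_rnDeriv_add_right P Q (fun _ => 1)
  have hb : ∀ x, ‖h x‖ ≤ 1 := fun x => by rw [Real.norm_of_nonneg (h0 x)]; exact h1 x
  have iph : Integrable (fun x => p x * h x) (P + Q) :=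
    ip.mul_bdd (c := 1) hm.aestronglyMeasurable (.of_forall hb)
  have iqh : Integrable (fun x => q x * h x) (P + Q) :=
    iq.mul_bdd (c := 1) hm.aestronglyMeasurable (.of_forall hb)
  rw [← integral_mul_rnDeriv_add_left P Q, ← integral_mul_rnDeriv_add_right P Q,
    ← integral_sub iph iqh]
  have : tvDist P Q = 1 / 2 * ∫ x, |p x - q x| ∂(P + Q) := rfl
  rw [this]
  have key : ∫ x, (p x * h x - q x * h x) ∂(P + Q)
      ≤ ∫ x, ((1 / 2) * |p x - q x| + (1 / 2) * (p x - q x)) ∂(P + Q) := by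
    refine integral_mono (iph.sub iqh)
      (((ip.sub iq).abs.const_mul _).add ((ip.sub iq).const_mul _)) fun x => ?_
    have a1 := le_abs_self (p x - q x)
    have a2 := neg_abs_le (p x - q x)
    have := h0 x
    have := h1 x
    nlinarith
  refine key.trans_eq ?_
  have ipq : Integrable (fun x => p x - q x) (P + Q) := ip.sub iq
  rw [integral_add (ipq.abs.const_mul _) (ipq.const_mul _), integral_const_mul,
    integral_const_mul, integral_sub ip iq, tp, tq]
  ring

/-- Data processing inequality for randomized maps. -/
theorem tvDist_bind_le (P Q : Measure α) [IsProbabilityMeasure P] [IsProbabilityMeasure Q]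
    (κ : Kernel α β) [IsMarkovKernel κ] : tvDist (P.bind κ) (Q.bind κ) ≤ tvDist P Q := by
  -- For the optimal set `A` after randomization, `x ↦ κ x A` is a `[0,1]`-valued test function for
  -- the original pair.
  obtain ⟨A, hA, h⟩ := exists_tvDist_eq (P.bind κ) (Q.bind κ)
  have e : ∀ ν : Measure α, (ν.bind κ).real A = ∫ x, (κ x).real A ∂ν := by
    intro ν
    rw [measureReal_def, Measure.bind_apply hA κ.measurable.aemeasurable]
    simp_rw [measureReal_def]
    rw [integral_toReal (κ.measurable_coe hA).aemeasurable (.of_forall fun x => measure_lt_top _ _)]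
  rw [h, e, e]
  exact integral_sub_integral_le_tvDist P Q (κ.measurable_coe hA).ennreal_toReal
    (fun x => measureReal_nonneg) (fun x => measureReal_le_one)

theorem tvDist_map_le (P Q : Measure α) [IsProbabilityMeasure P] [IsProbabilityMeasure Q]
    {f : α → β} (hf : Measurable f) : tvDist (P.map f) (Q.map f) ≤ tvDist P Q := by
  rw [← Measure.deterministic_comp_eq_map hf, ← Measure.deterministic_comp_eq_map hf]
  exact tvDist_bind_le P Q _

theorem tvDist_self (P : Measure α) [IsProbabilityMeasure P] : tvDist P P = 0 := by
  obtain ⟨A, -, h⟩ := exists_tvDist_eq P P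
  simpa using h

/-- Total variation is controlled by the symmetrized Kullback-Leibler divergence. -/
theorem tvDist_withDensity_le (P : Measure α) [IsProbabilityMeasure P] {g : α → ℝ}
    (hg : Measurable g) (hpos : ∀ᵐ x ∂P, 0 < g x)
    [hQ : IsProbabilityMeasure (P.withDensity fun x => ENNReal.ofReal (g x))]
    (hP : Integrable (fun x => Real.log (g x)) P)
    (hQl : Integrable (fun x => Real.log (g x)) (P.withDensity fun x => ENNReal.ofReal (g x)))
    {a : ℝ} (ha : 0 < a) :
    2 * tvDist P (P.withDensity fun x => ENNReal.ofReal (g x)) ≤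
      a / 2 * (∫ x, Real.log (g x) ∂(P.withDensity fun x => ENNReal.ofReal (g x)) -
        ∫ x, Real.log (g x) ∂P) + 1 / a := by
  set Q := P.withDensity fun x => ENNReal.ofReal (g x) with hQdef
  have hmg : Measurable fun x => ENNReal.ofReal (g x) := hg.ennreal_ofReal
  have trans : ∀ f : α → ℝ, ∫ x, f x ∂Q = ∫ x, g x * f x ∂P := by
    intro f
    rw [hQdef, integral_withDensity_eq_integral_toReal_smul hmg (by simp)]
    refine integral_congr_ae (hpos.mono fun x hx => ?_)
    simp [ENNReal.toReal_ofReal hx.le]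
  have itrans : ∀ f : α → ℝ, Integrable f Q → Integrable (fun x => g x * f x) P := by
    intro f hf
    rw [hQdef, integrable_withDensity_iff_integrable_smul' hmg (by simp)] at hf
    refine hf.congr (hpos.mono fun x hx => ?_)
    simp [ENNReal.toReal_ofReal hx.le]
  have ig : Integrable g P := by simpa using itrans (fun _ => 1) (integrable_const _)
  have tg : ∫ x, g x ∂P = 1 := by simpa using (trans fun _ => 1).symm
  have igl := itrans _ hQl
  obtain ⟨A, hA, h⟩ := exists_tvDist_eq P Q
  have iA : Integrable (A.indicator fun x => 1 - g x) P :=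
    (((integrable_const 1).sub ig).indicator hA)
  have e1 : P.real A - Q.real A = ∫ x, A.indicator (fun x => 1 - g x) x ∂P := by
    rw [← integral_indicator_one hA, ← integral_indicator_one hA, trans, ← integral_sub]
    · congr 1; ext x; by_cases hx : x ∈ A <;> simp [hx]
    · exact (integrable_const (1:ℝ)).indicator hA
    · refine (ig.indicator hA).congr (.of_forall fun x => ?_)
      by_cases hx : x ∈ A <;> simp [hx]
  -- The summand `1 - g` has mean zero; it turns a bound on `|1 - g|` into one on `2 · 1_A · (1 - g)
  -- ≤ |1 - g| + (1 - g)`.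
  have e2 : 2 * (P.real A - Q.real A) ≤
      ∫ x, (a / 2 * (g x * Real.log (g x) - Real.log (g x)) + 1 / (2 * a) * (g x + 1)
        + (1 - g x)) ∂P := by
    rw [e1, ← integral_const_mul]
    refine integral_mono_ae (iA.const_mul 2) ((((igl.sub hP).const_mul _).add
      ((ig.add (integrable_const 1)).const_mul _)).add ((integrable_const 1).sub ig)) ?_
    filter_upwards [hpos] with x hx
    have k1 : |1 - g x| ≤ a / 2 * (g x * Real.log (g x) - Real.log (g x))
        + 1 / (2 * a) * (g x + 1) := by
      set t := g x
      -- For `t ≥ 1` this follows from `log t ≥ 1 - 1/t`, for `t ≤ 1` from `log t ≤ t - 1`.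
      have hJ : (t - 1) ^ 2 ≤ (t * Real.log t - Real.log t) * (t + 1) := by
        have l1 := Real.log_le_sub_one_of_pos hx
        have l2 := Real.one_sub_inv_le_log_of_pos hx
        rcases le_total 1 t with h1 | h1
        · have : 0 ≤ (t - 1) * (Real.log t - (1 - t⁻¹)) * (t + 1) := by
            apply mul_nonneg (mul_nonneg _ _) <;> linarith
          have hh : (t - 1) * (1 - t⁻¹) * (t + 1) = (t - 1) ^ 2 * (t + 1) / t := by field_simp
          have : (t - 1) ^ 2 ≤ (t - 1) ^ 2 * (t + 1) / t := by
            rw [le_div_iff₀ hx]; nlinarith [sq_nonneg (t - 1)]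
          nlinarith
        · have : 0 ≤ (1 - t) * (t - 1 - Real.log t) * (t + 1) := by
            apply mul_nonneg (mul_nonneg _ _) <;> linarith
          nlinarith [mul_nonneg (sq_nonneg (t - 1)) hx.le]
      set J := t * Real.log t - Real.log t
      have hJ0 : 0 ≤ J := by
        by_contra hn
        nlinarith [sq_nonneg (t - 1)]
      -- By AM-GM the square of the right side is at least `J (t + 1)`, which dominates `(t - 1)²`.
      refine abs_le_of_sq_le_sq (a := 1 - t) ?_ (by positivity)
      have : (a / 2 * J + 1 / (2 * a) * (t + 1)) ^ 2
          = (a / 2 * J - 1 / (2 * a) * (t + 1)) ^ 2 + J * (t + 1) := by field_simp; ring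
      nlinarith [sq_nonneg (a / 2 * J - 1 / (2 * a) * (t + 1))]
    by_cases hxA : x ∈ A
    · simp only [Set.indicator_of_mem hxA]
      linarith [le_abs_self (1 - g x)]
    · simp only [Set.indicator_of_notMem hxA]
      linarith [neg_abs_le (1 - g x)]
  rw [h]
  refine e2.trans_eq ?_
  rw [integral_add, integral_add, integral_const_mul, integral_const_mul, integral_sub igl hP,
    integral_sub (integrable_const 1) ig, integral_add ig (integrable_const 1), trans, tg]
  · simp; ring
  · exact (igl.sub hP).const_mul _
  · exact (ig.add (integrable_const 1)).const_mul _
  · exact ((igl.sub hP).const_mul _).add ((ig.add (integrable_const 1)).const_mul _)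
  · exact (integrable_const 1).sub ig

end TotalVariation

/-! ### Densities of finite product measures. -/

section ProductDensities

theorem lintegral_fin_nat_prod_eq_prod {n : ℕ} {E : Type*} [MeasurableSpace E]
    (μ : Fin n → Measure E) [∀ i, SigmaFinite (μ i)] {f : Fin n → E → ℝ≥0∞}
    (hf : ∀ i, Measurable (f i)) :
    ∫⁻ x : Fin n → E, ∏ i, f i (x i) ∂(Measure.pi μ) = ∏ i, ∫⁻ x, f i x ∂(μ i) := by
  induction n with
  | zero => simp
  | succ n ih =>
    have hm : Measurable fun x : Fin (n + 1) → E => ∏ i, f i (x i) :=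
      Finset.measurable_fun_prod _ fun i _ => (hf i).comp (measurable_pi_apply i)
    rw [← (measurePreserving_piFinSuccAbove μ 0).symm.lintegral_comp hm]
    simp_rw [MeasurableEquiv.piFinSuccAbove_symm_apply, Fin.insertNthEquiv,
      Fin.prod_univ_succ, Fin.insertNth_zero, Equiv.coe_fn_mk, Fin.cons_succ,
      Fin.zero_succAbove, Fin.cons_zero]
    rw [← ih (fun i => μ i.succ) (f := fun i => f i.succ) (fun i => hf i.succ)]
    exact lintegral_prod_mul (hf 0).aemeasurable
      (Finset.measurable_fun_prod _
        fun (i : Fin n) _ => (hf i.succ).comp (measurable_pi_apply i)).aemeasurable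

theorem pi_withDensity {n : ℕ} {E : Type*} [MeasurableSpace E]
    (μ : Fin n → Measure E) [∀ i, SigmaFinite (μ i)] {f : Fin n → E → ℝ≥0∞}
    (hf : ∀ i, Measurable (f i)) [∀ i, SigmaFinite ((μ i).withDensity (f i))] :
    Measure.pi (fun i => (μ i).withDensity (f i)) =
      (Measure.pi μ).withDensity (fun x => ∏ i, f i (x i)) := by
  refine Measure.pi_eq fun s hs => ?_
  rw [withDensity_apply _ (.univ_pi hs), ← lintegral_indicator (.univ_pi hs)]
  have : ∀ x : Fin n → E, (Set.univ.pi s).indicator (fun x => ∏ i, f i (x i)) x =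
      ∏ i, (s i).indicator (f i) (x i) := by
    intro x
    by_cases h : x ∈ Set.univ.pi s
    · rw [Set.indicator_of_mem h]
      exact Finset.prod_congr rfl fun i _ => (Set.indicator_of_mem (h i trivial) _).symm
    · rw [Set.indicator_of_notMem h]
      simp only [Set.mem_pi, Set.mem_univ, true_implies, not_forall] at h
      obtain ⟨i, hi⟩ := h
      exact (Finset.prod_eq_zero (Finset.mem_univ i) (Set.indicator_of_notMem hi _)).symm
  simp_rw [this]
  rw [lintegral_fin_nat_prod_eq_prod μ fun i => (hf i).indicator (hs i)]
  exact Finset.prod_congr rfl fun i _ => by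
    rw [withDensity_apply _ (hs i), lintegral_indicator (hs i)]

end ProductDensities

/-! ### Gaussian samples under quadratic exponential tilting. -/

section GaussianTilting

variable {d N : ℕ}

/-- Left multiplication of every column of the data by a matrix. -/
def mulCols (B : Matrix (Fin d) (Fin d) ℝ) (x : Fin N → EuclideanSpace ℝ (Fin d)) :
    Fin N → EuclideanSpace ℝ (Fin d) :=
  fun j => Matrix.toEuclideanLin B (x j)

/-- The scatter matrix `∑ⱼ Xⱼ Xⱼᵀ`. -/
def scatter (x : Fin N → EuclideanSpace ℝ (Fin d)) : Matrix (Fin d) (Fin d) ℝ :=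
  dataMatrix x * (dataMatrix x).transpose

theorem continuous_toEuclideanLin (B : Matrix (Fin d) (Fin d) ℝ) :
    Continuous (Matrix.toEuclideanLin B) :=
  LinearMap.continuous_of_finiteDimensional _

@[fun_prop]
theorem continuous_mulCols (B : Matrix (Fin d) (Fin d) ℝ) :
    Continuous (mulCols (N := N) B) :=
  continuous_pi fun j => (continuous_toEuclideanLin B).comp (continuous_apply j)

@[fun_prop]
theorem continuous_dataMatrix : Continuous (dataMatrix (d := d) (N := N)) := by
  unfold dataMatrix
  refine continuous_pi fun i => continuous_pi fun j => ?_
  simp only [Matrix.of_apply]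
  fun_prop

@[fun_prop]
theorem continuous_scatter : Continuous (scatter (d := d) (N := N)) := by
  unfold scatter
  exact continuous_dataMatrix.matrix_mul continuous_dataMatrix.matrix_transpose

theorem dataMatrix_mulCols (B : Matrix (Fin d) (Fin d) ℝ) (x : Fin N → EuclideanSpace ℝ (Fin d)) :
    dataMatrix (mulCols B x) = B * dataMatrix x := by
  ext i j
  simp [dataMatrix, mulCols, Matrix.mul_apply, Matrix.mulVec, dotProduct]

theorem scatter_mulCols (B : Matrix (Fin d) (Fin d) ℝ) (x : Fin N → EuclideanSpace ℝ (Fin d)) :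
    scatter (mulCols B x) = B * scatter x * B.transpose := by
  simp only [scatter, dataMatrix_mulCols, Matrix.transpose_mul, Matrix.mul_assoc]

theorem scatter_eq_sum (x : Fin N → EuclideanSpace ℝ (Fin d)) :
    scatter x = ∑ j, Matrix.vecMulVec (x j).ofLp (x j).ofLp := by
  ext a b
  simp [scatter, dataMatrix, Matrix.mul_apply, Matrix.sum_apply, Matrix.vecMulVec_apply]

theorem natCast_smul_sampleCov (x : Fin N → EuclideanSpace ℝ (Fin d)) :
    (N : ℝ) • sampleCov x = scatter x := by
  rw [scatter_eq_sum, sampleCov]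
  rcases Nat.eq_zero_or_pos N with rfl | h
  · simp
  · rw [smul_smul, mul_inv_cancel₀ (by positivity), one_smul]

theorem sampleCov_eq (x : Fin N → EuclideanSpace ℝ (Fin d)) :
    sampleCov x = (N : ℝ)⁻¹ • scatter x := by
  rw [scatter_eq_sum, sampleCov]

theorem posSemidef_scatter (x : Fin N → EuclideanSpace ℝ (Fin d)) : (scatter x).PosSemidef := by
  have := Matrix.posSemidef_self_mul_conjTranspose (dataMatrix x)
  rwa [Matrix.conjTranspose_eq_transpose_of_trivial] at this

theorem trace_mul_scatter (T : Matrix (Fin d) (Fin d) ℝ) (x : Fin N → EuclideanSpace ℝ (Fin d)) :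
    (T * scatter x).trace = ∑ j, (x j).ofLp ⬝ᵥ T.mulVec (x j).ofLp := by
  rw [scatter_eq_sum, Finset.mul_sum, Matrix.trace_sum]
  refine Finset.sum_congr rfl fun j _ => ?_
  rw [Matrix.mul_vecMulVec, Matrix.trace_vecMulVec, dotProduct_comm]

theorem stdGaussian_eq_withDensity :
    stdGaussian (EuclideanSpace ℝ (Fin d)) = volume.withDensity
      (fun x => ENNReal.ofReal ((√(2 * Real.pi))⁻¹ ^ d * Real.exp (-‖x‖ ^ 2 / 2))) := by
  rw [← map_pi_eq_stdGaussian]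
  have hm : Measurable (fun x : EuclideanSpace ℝ (Fin d) =>
      ENNReal.ofReal ((√(2 * Real.pi))⁻¹ ^ d * Real.exp (-‖x‖ ^ 2 / 2))) := by fun_prop
  have hv := PiLp.volume_preserving_toLp (Fin d)
  have e : (Measure.pi fun _ : Fin d => gaussianReal 0 1) =
      (volume : Measure (Fin d → ℝ)).withDensity (fun x =>
        ENNReal.ofReal ((√(2 * Real.pi))⁻¹ ^ d * Real.exp (-‖WithLp.toLp 2 x‖ ^ 2 / 2))) := by
    simp_rw [gaussianReal_of_var_ne_zero 0 one_ne_zero]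
    have : SigmaFinite ((volume : Measure ℝ).withDensity (gaussianPDF 0 1)) := by
      rw [← gaussianReal_of_var_ne_zero 0 one_ne_zero]; infer_instance
    rw [pi_withDensity (fun _ => volume) (fun _ => measurable_gaussianPDF 0 1), volume_pi]
    congr 1
    ext x
    simp_rw [gaussianPDF]
    rw [← ENNReal.ofReal_prod_of_nonneg fun i _ => gaussianPDFReal_nonneg 0 1 _]
    simp_rw [gaussianPDFReal]
    rw [Finset.prod_mul_distrib, ← Real.exp_sum, EuclideanSpace.norm_sq_eq]
    simp [Finset.sum_div, neg_div]
  rw [e]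
  ext s hs
  rw [Measure.map_apply (by fun_prop) hs, withDensity_apply _ hs,
    withDensity_apply _ (hs.preimage (by fun_prop)), ← hv.setLIntegral_comp_preimage hs hm]

/-- Exponential tilting of a standard Gaussian by a quadratic form is a linear change of
variables. -/
theorem stdGaussian_tilt {B : Matrix (Fin d) (Fin d) ℝ} (hB : B.det ≠ 0) :
    (stdGaussian (EuclideanSpace ℝ (Fin d))).withDensity (fun x =>
      ENNReal.ofReal (Real.exp ((‖x‖ ^ 2 - ‖Matrix.toEuclideanLin B x‖ ^ 2) / 2))) =
    ENNReal.ofReal |B.det|⁻¹ •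
      (stdGaussian (EuclideanSpace ℝ (Fin d))).map (Matrix.toEuclideanLin B⁻¹) := by
  have hc := continuous_toEuclideanLin B
  have hc' := continuous_toEuclideanLin B⁻¹
  have hdet : LinearMap.det (Matrix.toEuclideanLin B) = B.det := by
    change LinearMap.det (Matrix.toLpLin 2 2 B) = B.det
    rw [Matrix.toLpLin_eq_toLin, LinearMap.det_toLin]
  have hm : Measurable (fun x : EuclideanSpace ℝ (Fin d) =>
      ENNReal.ofReal ((√(2 * Real.pi))⁻¹ ^ d * Real.exp (-‖x‖ ^ 2 / 2))) := by fun_prop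
  have hinv : ∀ x, Matrix.toEuclideanLin B⁻¹ (Matrix.toEuclideanLin B x) = x := by
    intro x
    ext i
    simp [Matrix.mulVec_mulVec, Matrix.nonsing_inv_mul B (isUnit_iff_ne_zero.2 hB)]
  rw [stdGaussian_eq_withDensity, ← withDensity_mul _ hm (by fun_prop)]
  ext s hs
  rw [withDensity_apply _ hs, Measure.smul_apply, Measure.map_apply hc'.measurable hs,
    withDensity_apply _ (hs.preimage hc'.measurable)]
  have hmap := Measure.map_linearMap_addHaar_eq_smul_addHaar
    (volume : Measure (EuclideanSpace ℝ (Fin d))) (f := Matrix.toEuclideanLin B) (by rwa [hdet])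
  rw [hdet, abs_inv] at hmap
  rw [← setLIntegral_smul_measure, ← hmap,
    setLIntegral_map (hs.preimage hc'.measurable) hm hc.measurable]
  have : Matrix.toEuclideanLin B ⁻¹' (Matrix.toEuclideanLin B⁻¹ ⁻¹' s) = s := by
    ext x; simp only [Set.mem_preimage, hinv]
  rw [this]
  refine lintegral_congr fun x => ?_
  rw [Pi.mul_apply, ← ENNReal.ofReal_mul (by positivity), mul_assoc, ← Real.exp_add]
  congr 3
  ring

theorem gaussianSample_one (N : ℕ) : gaussianSample (1 : Matrix (Fin d) (Fin d) ℝ) N =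
    Measure.pi fun _ : Fin N => stdGaussian (EuclideanSpace ℝ (Fin d)) := by
  simp only [gaussianSample, multivariateGaussian_zero_one]

instance (C : Matrix (Fin d) (Fin d) ℝ) : IsProbabilityMeasure (gaussianSample C N) := by
  unfold gaussianSample; infer_instance

/-- Reduction to identity covariance; singular covariances need no separate treatment. -/
theorem gaussianSample_eq_map (C : Matrix (Fin d) (Fin d) ℝ) (N : ℕ) :
    gaussianSample C N = (gaussianSample 1 N).map (mulCols (CFC.sqrt C)) := by
  rw [gaussianSample_one]
  have h := (continuous_toEuclideanLin (CFC.sqrt C)).measurable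
  have := Measure.isProbabilityMeasure_map (μ := stdGaussian (EuclideanSpace ℝ (Fin d)))
    h.aemeasurable
  unfold mulCols
  rw [Measure.pi_map_pi (fun _ => h.aemeasurable)]
  simp only [gaussianSample, multivariateGaussian, zero_add]
  rfl

/-- Tilting the joint law of a standard Gaussian sample. -/
theorem gaussianSample_tilt {B : Matrix (Fin d) (Fin d) ℝ} (hB : B.det ≠ 0) (N : ℕ)
    {F : (Fin N → EuclideanSpace ℝ (Fin d)) → ℝ≥0∞} (hF : Measurable F) :
    ∫⁻ x, ENNReal.ofReal (Real.exp (((scatter x).trace - (B.transpose * B * scatter x).trace) / 2))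
        * F x ∂(gaussianSample 1 N) =
      ENNReal.ofReal (|B.det|⁻¹ ^ N) * ∫⁻ x, F (mulCols B⁻¹ x) ∂(gaussianSample 1 N) := by
  have hc := continuous_toEuclideanLin B
  have hc' := continuous_toEuclideanLin B⁻¹
  have := Measure.isProbabilityMeasure_map (μ := stdGaussian (EuclideanSpace ℝ (Fin d)))
    hc'.measurable.aemeasurable
  set w := fun x : EuclideanSpace ℝ (Fin d) =>
      ENNReal.ofReal (Real.exp ((‖x‖ ^ 2 - ‖Matrix.toEuclideanLin B x‖ ^ 2) / 2)) with hw
  have mw : Measurable w := by fun_prop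
  have hfin : IsFiniteMeasure ((stdGaussian (EuclideanSpace ℝ (Fin d))).withDensity w) := by
    rw [stdGaussian_tilt hB]; exact Measure.smul_finite _ ENNReal.ofReal_ne_top
  have hfin' : IsFiniteMeasure (((stdGaussian (EuclideanSpace ℝ (Fin d))).map
      (Matrix.toEuclideanLin B⁻¹)).withDensity fun _ => ENNReal.ofReal |B.det|⁻¹) := by
    rw [withDensity_const]; exact Measure.smul_finite _ ENNReal.ofReal_ne_top
  have key : (gaussianSample 1 N).withDensity (fun x => ∏ j, w (x j)) =
      ENNReal.ofReal (|B.det|⁻¹ ^ N) • (gaussianSample 1 N).map (mulCols B⁻¹) := by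
    rw [gaussianSample_one, ← pi_withDensity _ fun _ => mw, stdGaussian_tilt hB]
    unfold mulCols
    rw [Measure.pi_map_pi (fun _ => hc'.measurable.aemeasurable)]
    -- The scalar `|det B|⁻¹` is read as a constant density, so that the product formula collects
    -- its `N`-th power.
    simp_rw [← withDensity_const]
    rw [pi_withDensity _ fun _ => measurable_const]
    simp only [Finset.prod_const, Finset.card_fin, withDensity_const]
    rw [ENNReal.ofReal_pow (by positivity)]
  have hwx : ∀ x : Fin N → EuclideanSpace ℝ (Fin d),
      ENNReal.ofReal (Real.exp (((scatter x).trace - (B.transpose * B * scatter x).trace) / 2)) =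
      ∏ j, w (x j) := by
    intro x
    simp_rw [hw]
    rw [← ENNReal.ofReal_prod_of_nonneg fun _ _ => (Real.exp_pos _).le, ← Real.exp_sum]
    congr 2
    rw [← Finset.sum_div, Finset.sum_sub_distrib, trace_mul_scatter]
    have h1 := trace_mul_scatter 1 x
    rw [Matrix.one_mul] at h1
    rw [h1]
    congr 2
    · refine Finset.sum_congr rfl fun j _ => ?_
      rw [EuclideanSpace.norm_sq_eq]
      simp [dotProduct, sq]
    · refine Finset.sum_congr rfl fun j _ => ?_
      rw [← Matrix.mulVec_mulVec, Matrix.dotProduct_mulVec, Matrix.vecMul_transpose]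
      rw [EuclideanSpace.norm_sq_eq]
      simp [dotProduct, sq]
  simp_rw [hwx]
  have mwp : Measurable fun x : Fin N → EuclideanSpace ℝ (Fin d) => ∏ j, w (x j) :=
    Finset.measurable_fun_prod _ fun i _ => mw.comp (measurable_pi_apply i)
  have e1 := lintegral_withDensity_eq_lintegral_mul (gaussianSample 1 N) mwp hF
  simp only [Pi.mul_apply] at e1
  rw [← e1, key, lintegral_smul_measure, lintegral_map hF (continuous_mulCols _).measurable,
    smul_eq_mul]

end GaussianTilting

/-! ### Uniqueness of Laplace transforms on symmetric matrices. -/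

section LaplaceUniqueness

open Filter Topology

/-- Two finite measures whose moment generating functions are finite and agree near `0` along every
linear functional are equal. -/
theorem Measure.ext_of_lintegral_exp {E : Type*} [NormedAddCommGroup E] [NormedSpace ℝ E]
    [CompleteSpace E] [SecondCountableTopology E] [MeasurableSpace E] [BorelSpace E]
    {P Q : Measure E} [IsFiniteMeasure P] [IsFiniteMeasure Q]
    (h : ∀ L : StrongDual ℝ E, ∀ᶠ t : ℝ in 𝓝 0,
      ∫⁻ x, ENNReal.ofReal (Real.exp (t * L x)) ∂P ≠ ∞ ∧
      ∫⁻ x, ENNReal.ofReal (Real.exp (t * L x)) ∂P =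
        ∫⁻ x, ENNReal.ofReal (Real.exp (t * L x)) ∂Q) : P = Q := by
  refine Measure.ext_of_charFunDual (funext fun L => ?_)
  have int : ∀ (ν : Measure E) (t : ℝ), ∫⁻ x, ENNReal.ofReal (Real.exp (t * L x)) ∂ν ≠ ∞ →
      Integrable (fun x => Real.exp (t * L x)) ν := by
    intro ν t ht
    refine (lintegral_ofReal_ne_top_iff_integrable (by fun_prop)
      (.of_forall fun x => (Real.exp_pos _).le)).1 ht
  have h0P : (0 : ℝ) ∈ interior (integrableExpSet L P) := by
    rw [mem_interior_iff_mem_nhds]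
    exact (h L).mono fun t ht => int P t ht.1
  have h0Q : (0 : ℝ) ∈ interior (integrableExpSet L Q) := by
    rw [mem_interior_iff_mem_nhds]
    exact (h L).mono fun t ht => int Q t (ht.2 ▸ ht.1)
  set U := interior (integrableExpSet L P) ∩ interior (integrableExpSet L Q) with hU
  have hX : AnalyticOnNhd ℂ (complexMGF L P) {z | z.re ∈ U} :=
    analyticOnNhd_complexMGF.mono fun z hz => hz.1
  have hY : AnalyticOnNhd ℂ (complexMGF L Q) {z | z.re ∈ U} :=
    analyticOnNhd_complexMGF.mono fun z hz => hz.2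
  have hconv : Convex ℝ U :=
    convex_integrableExpSet.interior.inter convex_integrableExpSet.interior
  -- Identity theorem on a vertical strip around the imaginary axis: agreement at real points
  -- accumulating at `0` propagates to the whole strip, and the value at `I` is the characteristic
  -- function.
  have heq : Set.EqOn (complexMGF L P) (complexMGF L Q) {z | z.re ∈ U} := by
    refine hX.eqOn_of_preconnected_of_frequently_eq hY
      (hconv.linear_preimage Complex.reLm).isPreconnected (z₀ := ((0 : ℝ) : ℂ))
      (by simp [hU, h0P, h0Q]) ?_
    have h_real : ∃ᶠ t : ℝ in 𝓝[≠] 0, complexMGF L P t = complexMGF L Q t := by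
      refine ((h L).filter_mono nhdsWithin_le_nhds).frequently.mono fun t ht => ?_
      rw [complexMGF_ofReal, complexMGF_ofReal, mgf, mgf,
        integral_eq_lintegral_of_nonneg_ae (.of_forall fun x => (Real.exp_pos _).le) (by fun_prop),
        integral_eq_lintegral_of_nonneg_ae (.of_forall fun x => (Real.exp_pos _).le) (by fun_prop),
        ht.2]
    have hcont : Tendsto (fun t : ℝ => (t : ℂ)) (𝓝[≠] 0) (𝓝[≠] ((0 : ℝ) : ℂ)) := by
      refine tendsto_nhdsWithin_iff.2
        ⟨(Complex.continuous_ofReal.tendsto 0).mono_left nhdsWithin_le_nhds, ?_⟩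
      filter_upwards [self_mem_nhdsWithin] with t ht
      simpa using ht
    exact hcont.frequently h_real
  have := heq (x := Complex.I) (by simp [hU, h0P, h0Q])
  simpa [complexMGF, charFunDual_apply, mul_comm] using this

/-- The crude estimate `|xᵀTx| ≤ (∑ |Tᵢⱼ|) xᵀx` shows that small symmetric perturbations of `s I`
stay positive definite. -/
theorem posDef_smul_one_add_smul {d : ℕ} {T : Matrix (Fin d) (Fin d) ℝ} (hT : T.IsHermitian)
    {s : ℝ} (hs : 0 < s) : ∀ᶠ t : ℝ in 𝓝 0,
      (s • (1 : Matrix (Fin d) (Fin d) ℝ) + t • T).PosDef := by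
  set K := ∑ i, ∑ j, |T i j| with hK
  have hK0 : 0 ≤ K := by positivity
  have : ∀ᶠ t : ℝ in 𝓝 0, |t| * K < s := by
    have : Tendsto (fun t : ℝ => |t| * K) (𝓝 0) (𝓝 (|0| * K)) := by
      refine Continuous.tendsto ?_ 0; fun_prop
    simp only [abs_zero, zero_mul] at this
    exact this.eventually_lt_const hs
  filter_upwards [this] with t ht
  refine Matrix.PosDef.of_dotProduct_mulVec_pos ?_ fun x hx => ?_
  · refine (Matrix.isHermitian_one.smul ?_).add (hT.smul ?_)
    · exact IsSelfAdjoint.all s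
    · exact IsSelfAdjoint.all t
  · have hpos : 0 < x ⬝ᵥ x := by
      have := (Matrix.dotProduct_star_self_pos_iff (v := x)).2 hx
      simpa using this
    have hq : |x ⬝ᵥ T.mulVec x| ≤ K * (x ⬝ᵥ x) := by
      have hx2 : ∀ i, x i ^ 2 ≤ x ⬝ᵥ x := fun i => by
        rw [dotProduct]
        have := Finset.single_le_sum (f := fun i => x i * x i)
          (fun i _ => mul_self_nonneg _) (Finset.mem_univ i)
        simpa [sq] using this
      have hxx : ∀ i j, |x i * x j| ≤ x ⬝ᵥ x := fun i j => by
        have h1 := hx2 i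
        have h2 := hx2 j
        rw [abs_le]
        constructor <;> nlinarith [sq_nonneg (x i + x j), sq_nonneg (x i - x j)]
      simp only [dotProduct, Matrix.mulVec] at *
      rw [hK, Finset.sum_mul]
      refine (Finset.abs_sum_le_sum_abs _ _).trans (Finset.sum_le_sum fun i _ => ?_)
      rw [Finset.mul_sum, Finset.sum_mul]
      refine (Finset.abs_sum_le_sum_abs _ _).trans (Finset.sum_le_sum fun j _ => ?_)
      have : x i * (T i j * x j) = T i j * (x i * x j) := by ring
      rw [this, abs_mul]
      exact mul_le_mul_of_nonneg_left (hxx i j) (abs_nonneg _)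
    simp only [star_trivial, Matrix.add_mulVec, Matrix.smul_mulVec, Matrix.one_mulVec,
      dotProduct_add, dotProduct_smul, smul_eq_mul]
    have h1 : -(|t| * (K * (x ⬝ᵥ x))) ≤ t * (x ⬝ᵥ T.mulVec x) := by
      have := neg_abs_le (t * (x ⬝ᵥ T.mulVec x))
      rw [abs_mul] at this
      have := mul_le_mul_of_nonneg_left hq (abs_nonneg t)
      linarith
    nlinarith

/-- Finite measures on symmetric matrices are determined by their Laplace transforms. -/
theorem Measure.ext_of_lintegral_exp_trace {d : ℕ} {P Q : Measure (Matrix (Fin d) (Fin d) ℝ)}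
    [IsFiniteMeasure P] [IsFiniteMeasure Q] (hP : ∀ᵐ S ∂P, S.IsHermitian)
    (hQ : ∀ᵐ S ∂Q, S.IsHermitian) {s : ℝ} (hs : 0 < s)
    (h : ∀ T : Matrix (Fin d) (Fin d) ℝ, (s • (1 : Matrix (Fin d) (Fin d) ℝ) + T).PosDef →
      ∫⁻ S, ENNReal.ofReal (Real.exp (-(T * S).trace)) ∂P ≠ ∞ ∧
      ∫⁻ S, ENNReal.ofReal (Real.exp (-(T * S).trace)) ∂P =
        ∫⁻ S, ENNReal.ofReal (Real.exp (-(T * S).trace)) ∂Q) : P = Q := by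
  -- On the underlying function space the sup norm supplies the normed structure that the
  -- vector-space statement asks for.
  let P' : Measure (Fin d → Fin d → ℝ) := P
  let Q' : Measure (Fin d → Fin d → ℝ) := Q
  have : IsFiniteMeasure P' := inferInstanceAs (IsFiniteMeasure P)
  have : IsFiniteMeasure Q' := inferInstanceAs (IsFiniteMeasure Q)
  suffices P' = Q' from this
  refine Measure.ext_of_lintegral_exp fun L => ?_
  set A : Matrix (Fin d) (Fin d) ℝ :=
    Matrix.of fun i j => L (Pi.single j (Pi.single i 1)) with hA
  have hL : ∀ S : Matrix (Fin d) (Fin d) ℝ, L S = (A * S).trace := by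
    intro S
    have : (S : Fin d → Fin d → ℝ) = ∑ j, ∑ i, S j i • Pi.single j (Pi.single i 1) := by
      ext a b
      simp [Finset.sum_apply, Pi.single_apply, apply_ite, ite_apply]
    conv_lhs => rw [this]
    simp only [map_sum, map_smul, smul_eq_mul, Matrix.trace, Matrix.diag, Matrix.mul_apply, hA,
      Matrix.of_apply]
    rw [Finset.sum_comm]
    exact Finset.sum_congr rfl fun i _ => Finset.sum_congr rfl fun j _ => mul_comm _ _
  -- The functional `L` is `S ↦ tr(AS)`. On symmetric `S` only the symmetric part of `A` acts, and
  -- positive definiteness of `s I + t T` requires a symmetric `T`.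
  set T := (-(1 / 2 : ℝ)) • (A + A.transpose) with hT
  have hTh : T.IsHermitian := by
    rw [hT, Matrix.IsHermitian, Matrix.conjTranspose_eq_transpose_of_trivial,
      Matrix.transpose_smul, Matrix.transpose_add, Matrix.transpose_transpose, add_comm]
  have hLS : ∀ S : Matrix (Fin d) (Fin d) ℝ, S.IsHermitian → ∀ t : ℝ,
      t * L S = -((t • T) * S).trace := by
    intro S hS t
    have h1 : (A.transpose * S).trace = (A * S).trace := by
      rw [← Matrix.trace_transpose, Matrix.transpose_mul, Matrix.transpose_transpose,
        Matrix.trace_mul_comm, ← Matrix.conjTranspose_eq_transpose_of_trivial S, hS.eq]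
    rw [hL, hT, Matrix.smul_mul, Matrix.smul_mul, Matrix.add_mul, Matrix.trace_smul,
      Matrix.trace_smul, Matrix.trace_add, h1, smul_eq_mul, smul_eq_mul]
    ring
  filter_upwards [posDef_smul_one_add_smul hTh hs] with t ht
  have e1 : ∫⁻ S, ENNReal.ofReal (Real.exp (t * L S)) ∂P =
      ∫⁻ S, ENNReal.ofReal (Real.exp (-((t • T) * S).trace)) ∂P :=
    lintegral_congr_ae (hP.mono fun S hS => by simp only [hLS S hS])
  have e2 : ∫⁻ S, ENNReal.ofReal (Real.exp (t * L S)) ∂Q =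
      ∫⁻ S, ENNReal.ofReal (Real.exp (-((t • T) * S).trace)) ∂Q :=
    lintegral_congr_ae (hQ.mono fun S hS => by simp only [hLS S hS])
  have := h (t • T) ht
  exact ⟨e1.trans_ne this.1, e1.trans (this.2.trans e2.symm)⟩

end LaplaceUniqueness

/-! ### Determinant moments and the relative density of Wishart laws. -/

section WishartLaw

variable {d : ℕ}

/-- The data set with a prescribed data matrix. -/
def columns {N : ℕ} (U : Matrix (Fin d) (Fin N) ℝ) : Fin N → EuclideanSpace ℝ (Fin d) :=
  fun j => WithLp.toLp 2 fun i => U i j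

@[simp]
theorem dataMatrix_columns {N : ℕ} (U : Matrix (Fin d) (Fin N) ℝ) :
    dataMatrix (columns U) = U := rfl

@[simp]
theorem columns_dataMatrix {N : ℕ} (x : Fin N → EuclideanSpace ℝ (Fin d)) :
    columns (dataMatrix x) = x := rfl

/-- The rectangular identity matrix `[I 0]`. -/
def rectId (d N : ℕ) : Matrix (Fin d) (Fin N) ℝ :=
  Matrix.of fun i j => if (i : ℕ) = j then 1 else 0

theorem rectId_mul_transpose {N : ℕ} (h : d ≤ N) :
    rectId d N * (rectId d N).transpose = 1 := by
  ext i k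
  simp only [rectId, Matrix.mul_apply, Matrix.of_apply, Matrix.transpose_apply, Matrix.one_apply]
  rw [Finset.sum_eq_single (Fin.castLE h i)]
  · by_cases hik : i = k
    · simp [hik]
    · have : (k : ℕ) ≠ i := fun h' => hik (Fin.ext h'.symm)
      simp [hik, this]
  · intro j _ hj
    have : (i : ℕ) ≠ j := fun h' => hj (Fin.ext h'.symm)
    simp [this]
  · simp

theorem isOpenPosMeasure_stdGaussian :
    (stdGaussian (EuclideanSpace ℝ (Fin d))).IsOpenPosMeasure := by
  have hac : (volume : Measure (EuclideanSpace ℝ (Fin d))) ≪ stdGaussian _ := by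
    rw [stdGaussian_eq_withDensity]
    refine withDensity_absolutelyContinuous' (by fun_prop) (.of_forall fun x => ?_)
    have : 0 < (√(2 * Real.pi))⁻¹ ^ d * Real.exp (-‖x‖ ^ 2 / 2) := by positivity
    simpa using this
  exact hac.isOpenPosMeasure

/-- Invertibility is an open condition met by the data matrix `[I 0]`, and the Gaussian law charges
open sets. Positive probability is enough to make `detMoment` nonzero; almost sure invertibility is
deduced afterwards in `ae_det_scatter_pos`. -/
theorem gaussianSample_one_det_scatter_ne_zero {n : ℕ} (h : d ≤ n) :
    0 < gaussianSample (1 : Matrix (Fin d) (Fin d) ℝ) n {x | (scatter x).det ≠ 0} := by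
  rw [gaussianSample_one]
  have := @Measure.pi.isOpenPosMeasure (Fin n) (fun _ => EuclideanSpace ℝ (Fin d)) _ _
    (fun _ => stdGaussian (EuclideanSpace ℝ (Fin d))) _ _ fun _ => isOpenPosMeasure_stdGaussian
  refine IsOpen.measure_pos _ (isOpen_ne_fun (by fun_prop) continuous_const)
    ⟨columns (rectId d n), ?_⟩
  simp [scatter, rectId_mul_transpose h]

theorem Matrix.PosSemidef.det_le_trace_pow {A : Matrix (Fin d) (Fin d) ℝ} (hA : A.PosSemidef) :
    A.det ≤ A.trace ^ d := by
  rw [hA.isHermitian.det_eq_prod_eigenvalues, hA.isHermitian.trace_eq_sum_eigenvalues]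
  simp only [RCLike.ofReal_real_eq_id, id]
  calc ∏ i, hA.isHermitian.eigenvalues i
      ≤ ∏ _i : Fin d, ∑ i, hA.isHermitian.eigenvalues i :=
        Finset.prod_le_prod (fun i _ => hA.eigenvalues_nonneg i) fun i _ =>
          Finset.single_le_sum (fun j _ => hA.eigenvalues_nonneg j) (Finset.mem_univ i)
    _ = _ := by simp

/-- Tilting with `B = I/√2` turns the exponent into `(tr - tr/2)/2 = tr/4`, and the tilted mass is
explicit. -/
theorem lintegral_exp_trace_scatter_lt_top (d n : ℕ) :
    ∫⁻ x, ENNReal.ofReal (Real.exp ((scatter x).trace / 4))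
      ∂(gaussianSample (1 : Matrix (Fin d) (Fin d) ℝ) n) < ∞ := by
  have hdet : ((√2)⁻¹ • (1 : Matrix (Fin d) (Fin d) ℝ)).det ≠ 0 := by
    rw [Matrix.det_smul, Matrix.det_one]; positivity
  have := gaussianSample_tilt hdet n (F := fun _ => 1) measurable_const
  have hB : ((√2)⁻¹ • (1 : Matrix (Fin d) (Fin d) ℝ)).transpose * ((√2)⁻¹ • 1)
      = (1 / 2 : ℝ) • 1 := by
    rw [Matrix.transpose_smul, Matrix.transpose_one, Matrix.smul_mul, Matrix.one_mul, smul_smul,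
      ← mul_inv, Real.mul_self_sqrt (by norm_num)]
    norm_num
  rw [hB] at this
  simp only [Matrix.smul_mul, Matrix.one_mul, Matrix.trace_smul, mul_one, lintegral_one,
    measure_univ, smul_eq_mul] at this
  have e : ∀ x : Fin n → EuclideanSpace ℝ (Fin d),
      (scatter x).trace / 4 = ((scatter x).trace - 1 / 2 * (scatter x).trace) / 2 := by
    intro x; ring
  simp_rw [e]
  rw [this]
  exact ENNReal.ofReal_lt_top

/-- Half-integer moments `E (det W)^{k/2}` of the determinant of a Wishart matrix. -/
def detMoment (d n k : ℕ) : ℝ≥0∞ :=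
  ∫⁻ x, ENNReal.ofReal (√(scatter x).det ^ k) ∂(gaussianSample (1 : Matrix (Fin d) (Fin d) ℝ) n)

theorem detMoment_lt_top (d n k : ℕ) : detMoment d n k < ∞ := by
  -- Chosen from `√D ^ k ≤ 1 + D ^ k ≤ 1 + t ^ (dk)` and `(t/4) ^ (dk) / (dk)! ≤ exp (t/4)`, with
  -- `D` the determinant and `t` the trace.
  set c : ℝ := 1 + (d * k).factorial * 4 ^ (d * k)
  have hle : ∀ x : Fin n → EuclideanSpace ℝ (Fin d),
      √(scatter x).det ^ k ≤ c * Real.exp ((scatter x).trace / 4) := by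
    intro x
    have hp := posSemidef_scatter x
    set D := (scatter x).det
    set t := (scatter x).trace
    have hD : 0 ≤ D := hp.det_nonneg
    have ht : 0 ≤ t := hp.trace_nonneg
    have h1 : √D ^ k ≤ 1 + D ^ k := by
      have : (√D ^ k) ^ 2 = D ^ k := by rw [← pow_mul, mul_comm, pow_mul, Real.sq_sqrt hD]
      nlinarith [sq_nonneg (√D ^ k - 1), sq_nonneg (√D ^ k)]
    have h2 : D ^ k ≤ t ^ (d * k) := by
      rw [pow_mul]; exact pow_le_pow_left₀ hD hp.det_le_trace_pow k
    have h3 := Real.pow_div_factorial_le_exp (t / 4) (by positivity) (d * k)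
    rw [div_pow, div_div, div_le_iff₀ (by positivity)] at h3
    have h4 : 1 ≤ Real.exp (t / 4) := Real.one_le_exp (by positivity)
    calc √D ^ k ≤ 1 + D ^ k := h1
      _ ≤ Real.exp (t / 4) + Real.exp (t / 4) * (4 ^ (d * k) * (d * k).factorial) := by linarith
      _ = _ := by ring
  refine (lintegral_mono fun x => ENNReal.ofReal_le_ofReal (hle x)).trans_lt ?_
  simp_rw [ENNReal.ofReal_mul (show 0 ≤ c by positivity)]
  rw [lintegral_const_mul' _ _ ENNReal.ofReal_ne_top]
  exact ENNReal.mul_lt_top ENNReal.ofReal_lt_top (lintegral_exp_trace_scatter_lt_top d n)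

theorem detMoment_pos {n : ℕ} (h : d ≤ n) (k : ℕ) : 0 < detMoment d n k := by
  rw [detMoment, lintegral_pos_iff_support (by fun_prop)]
  refine (gaussianSample_one_det_scatter_ne_zero h).trans_le (measure_mono fun x hx => ?_)
  have hD : 0 < (scatter x).det := lt_of_le_of_ne (posSemidef_scatter x).det_nonneg (Ne.symm hx)
  have : 0 < √(scatter x).det ^ k := by positivity
  exact (ENNReal.ofReal_pos.2 this).ne'

theorem Matrix.PosDef.exists_transpose_mul_self {A : Matrix (Fin d) (Fin d) ℝ} (hA : A.PosDef) :
    ∃ B : Matrix (Fin d) (Fin d) ℝ, B.det ≠ 0 ∧ B.transpose * B = A := by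
  refine ⟨CFC.sqrt A, ?_, ?_⟩
  · have h : CFC.sqrt A * CFC.sqrt A = A := CFC.sqrt_mul_sqrt_self A hA.posSemidef.nonneg
    intro h0
    have := hA.det_pos
    rw [← h, Matrix.det_mul, h0] at this
    simp at this
  · have hs : (CFC.sqrt A).transpose = CFC.sqrt A := by
      have := (Matrix.nonneg_iff_posSemidef.1 (CFC.sqrt_nonneg A)).isHermitian
      rwa [Matrix.IsHermitian, Matrix.conjTranspose_eq_transpose_of_trivial] at this
    rw [hs, CFC.sqrt_mul_sqrt_self A hA.posSemidef.nonneg]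

/-- Under `x ↦ B⁻¹x` the factor `√det ^ k` contributes `|det B|⁻¹ ^ k` on top of the `|det B|⁻¹ ^ n`
from the tilt. The dependence on `B` is thus that of a sample of size `n + k`, which is what
identifies the weighted law. -/
theorem lintegral_exp_det_scatter {B : Matrix (Fin d) (Fin d) ℝ} (hB : B.det ≠ 0) (n k : ℕ) :
    ∫⁻ x, ENNReal.ofReal (Real.exp (((scatter x).trace - (B.transpose * B * scatter x).trace) / 2))
        * ENNReal.ofReal (√(scatter x).det ^ k) ∂(gaussianSample 1 n) =
      ENNReal.ofReal (|B.det|⁻¹ ^ (n + k)) * detMoment d n k := by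
  rw [gaussianSample_tilt hB n (F := fun x => ENNReal.ofReal (√(scatter x).det ^ k))
    (by fun_prop), detMoment, pow_add, ENNReal.ofReal_mul (by positivity), mul_assoc]
  congr 1
  rw [← lintegral_const_mul' _ _ ENNReal.ofReal_ne_top]
  refine lintegral_congr fun x => ?_
  rw [← ENNReal.ofReal_mul (by positivity), ← mul_pow, scatter_mulCols]
  congr 2
  rw [Matrix.det_mul, Matrix.det_mul, Matrix.det_transpose, Matrix.det_nonsing_inv,
    Ring.inverse_eq_inv', mul_right_comm, Real.sqrt_mul (mul_self_nonneg _),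
    Real.sqrt_mul_self_eq_abs, abs_inv]

/-- Weighting a Wishart law by a power of the determinant and an exponential of the trace changes
its shape parameter and its scale. -/
theorem map_scatter_withDensity (d n k : ℕ) {s : ℝ} (hs : 0 < s) :
    ((gaussianSample (1 : Matrix (Fin d) (Fin d) ℝ) n).map scatter).withDensity
      (fun S => ENNReal.ofReal (√S.det ^ k * Real.exp (-((s - 1) / 2) * S.trace))) =
    (detMoment d n k * ENNReal.ofReal (((√s ^ d) ^ (n + k))⁻¹)) •
      (gaussianSample (1 : Matrix (Fin d) (Fin d) ℝ) (n + k)).map (fun x => s⁻¹ • scatter x) := by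
  set c := detMoment d n k * ENNReal.ofReal (((√s ^ d) ^ (n + k))⁻¹) with hc
  have hcfin : c ≠ ∞ := ENNReal.mul_ne_top (detMoment_lt_top d n k).ne ENNReal.ofReal_ne_top
  have hdet : Measurable fun S : Matrix (Fin d) (Fin d) ℝ => S.det :=
    (continuous_id.matrix_det).measurable
  have htr : ∀ T : Matrix (Fin d) (Fin d) ℝ,
      Measurable fun S : Matrix (Fin d) (Fin d) ℝ => (T * S).trace := fun T =>
    (Continuous.matrix_trace (by fun_prop)).measurable
  have htr1 : Measurable fun S : Matrix (Fin d) (Fin d) ℝ => S.trace := by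
    simpa using htr 1
  have hms : Measurable (scatter (d := d) (N := n)) := continuous_scatter.measurable
  have hms' : Measurable (fun x : Fin (n + k) → EuclideanSpace ℝ (Fin d) => s⁻¹ • scatter x) :=
    (continuous_scatter.const_smul s⁻¹).measurable
  have mw : Measurable fun S : Matrix (Fin d) (Fin d) ℝ =>
      ENNReal.ofReal (√S.det ^ k * Real.exp (-((s - 1) / 2) * S.trace)) := by fun_prop
  set P := ((gaussianSample (1 : Matrix (Fin d) (Fin d) ℝ) n).map scatter).withDensity
      (fun S => ENNReal.ofReal (√S.det ^ k * Real.exp (-((s - 1) / 2) * S.trace))) with hP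
  set Q := c • (gaussianSample (1 : Matrix (Fin d) (Fin d) ℝ) (n + k)).map
    (fun x => s⁻¹ • scatter x) with hQ
  have mexp : ∀ T : Matrix (Fin d) (Fin d) ℝ, Measurable fun S : Matrix (Fin d) (Fin d) ℝ =>
      ENNReal.ofReal (Real.exp (-(T * S).trace)) := fun T =>
    ((htr T).neg.exp).ennreal_ofReal
  have main : ∀ T : Matrix (Fin d) (Fin d) ℝ,
      ((s / 2) • (1 : Matrix (Fin d) (Fin d) ℝ) + T).PosDef →
      ∫⁻ S, ENNReal.ofReal (Real.exp (-(T * S).trace)) ∂P ≠ ∞ ∧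
      ∫⁻ S, ENNReal.ofReal (Real.exp (-(T * S).trace)) ∂P =
        ∫⁻ S, ENNReal.ofReal (Real.exp (-(T * S).trace)) ∂Q := by
    intro T hT
    -- Here `BᵀB = s I + 2T`, so that the tilt by `B` combines the weight `exp(-(s-1)/2 · tr)` with
    -- the Laplace kernel `exp(-tr(T·))`.
    obtain ⟨B, hB, hBT⟩ := (hT.smul (by norm_num : (0 : ℝ) < 2)).exists_transpose_mul_self
    have hBtr : ∀ S, (B.transpose * B * S).trace = s * S.trace + 2 * (T * S).trace := by
      intro S
      rw [hBT, Matrix.smul_mul, Matrix.add_mul, Matrix.smul_mul, Matrix.one_mul,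
        Matrix.trace_smul, Matrix.trace_add, Matrix.trace_smul, smul_eq_mul, smul_eq_mul]
      ring
    have l : ∫⁻ S, ENNReal.ofReal (Real.exp (-(T * S).trace)) ∂P =
        ENNReal.ofReal (|B.det|⁻¹ ^ (n + k)) * detMoment d n k := by
      rw [← lintegral_exp_det_scatter hB, hP, lintegral_withDensity_eq_lintegral_mul _ mw (mexp T),
        lintegral_map (mw.mul (mexp T)) hms]
      refine lintegral_congr fun x => ?_
      rw [Pi.mul_apply, ← ENNReal.ofReal_mul (by positivity), ← ENNReal.ofReal_mul (by positivity),
        mul_assoc, ← Real.exp_add, mul_comm, hBtr]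
      congr 3
      ring
    have hB' : ((√s)⁻¹ • B).det ≠ 0 := by
      rw [Matrix.det_smul]
      exact mul_ne_zero (by positivity) hB
    -- The scaled Wishart side is the unweighted case `k = 0` with `n + k` observations and `B/√s`.
    have r := lintegral_exp_det_scatter hB' (n + k) 0
    have hm0 : detMoment d (n + k) 0 = 1 := by simp [detMoment]
    rw [hm0] at r
    have r2 : ∫⁻ S, ENNReal.ofReal (Real.exp (-(T * S).trace)) ∂Q =
        c * ENNReal.ofReal (|((√s)⁻¹ • B).det|⁻¹ ^ (n + k)) := by
      rw [hQ, lintegral_smul_measure, lintegral_map (mexp T) hms', smul_eq_mul]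
      simp only [add_zero, mul_one] at r
      rw [← r]
      congr 1
      refine lintegral_congr fun x => ?_
      simp only [pow_zero, ENNReal.ofReal_one, mul_one]
      congr 2
      have hBB : ((√s)⁻¹ • B).transpose * ((√s)⁻¹ • B) = s⁻¹ • (B.transpose * B) := by
        rw [Matrix.transpose_smul, Matrix.smul_mul, Matrix.mul_smul, smul_smul, ← mul_inv,
          Real.mul_self_sqrt hs.le]
      rw [hBB, Matrix.smul_mul, Matrix.trace_smul, hBtr, Matrix.mul_smul,
        Matrix.trace_smul, smul_eq_mul, smul_eq_mul]
      field_simp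
      ring
    refine ⟨?_, ?_⟩
    · rw [l]
      exact ENNReal.mul_ne_top ENNReal.ofReal_ne_top (detMoment_lt_top d n k).ne
    · rw [l, r2, hc, mul_comm, mul_assoc, ← ENNReal.ofReal_mul (by positivity)]
      congr 2
      have hdB : |((√s)⁻¹ • B).det|⁻¹ = √s ^ d * |B.det|⁻¹ := by
        rw [Matrix.det_smul, Fintype.card_fin, abs_mul, mul_inv, abs_pow, abs_inv,
          abs_of_nonneg (Real.sqrt_nonneg s), inv_pow, inv_inv]
      rw [hdB, mul_pow, ← mul_assoc, inv_mul_cancel₀ (by positivity), one_mul]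
  -- The Laplace transform at `T = 0` is the total mass.
  have hPfin : IsFiniteMeasure P := by
    have h0 := (main 0 (by
      rw [add_zero]; exact Matrix.PosDef.one.smul (by positivity))).1
    simp only [Matrix.zero_mul, Matrix.trace_zero, neg_zero, Real.exp_zero, ENNReal.ofReal_one,
      lintegral_one] at h0
    exact ⟨h0.lt_top⟩
  have hQfin : IsFiniteMeasure Q := Measure.smul_finite _ hcfin
  have hherm : MeasurableSet {S : Matrix (Fin d) (Fin d) ℝ | S.IsHermitian} :=
    (isClosed_eq (continuous_id.matrix_conjTranspose) continuous_id).measurableSet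
  refine Measure.ext_of_lintegral_exp_trace ?_ ?_ (by positivity : 0 < s / 2) main
  · have hac : P ≪ (gaussianSample (1 : Matrix (Fin d) (Fin d) ℝ) n).map scatter :=
      withDensity_absolutelyContinuous _ _
    refine Filter.Eventually.filter_mono hac.ae_le ?_
    rw [ae_map_iff hms.aemeasurable hherm]
    exact .of_forall fun x => (posSemidef_scatter x).isHermitian
  · refine Measure.ae_smul_measure ?_ c
    rw [ae_map_iff hms'.aemeasurable hherm]
    exact .of_forall fun x => (posSemidef_scatter x).isHermitian.smul (IsSelfAdjoint.all _)

end WishartLaw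

/-! ### Mean determinants, size-biasing, and increments of the mean log-determinant. -/

section Determinants

variable {d : ℕ}

theorem detMoment_two (d n : ℕ) : detMoment d n 2 =
    ∫⁻ x, ENNReal.ofReal (scatter x).det ∂(gaussianSample (1 : Matrix (Fin d) (Fin d) ℝ) n) := by
  refine lintegral_congr fun x => ?_
  rw [Real.sq_sqrt (posSemidef_scatter x).det_nonneg]

theorem scatter_succAbove {k : ℕ} (i : Fin (k + 1))
    (x : Fin (k + 1) → EuclideanSpace ℝ (Fin d)) :
    scatter x = Matrix.vecMulVec (x i).ofLp (x i).ofLp + scatter (fun j => x (i.succAbove j)) := by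
  rw [scatter_eq_sum, scatter_eq_sum, Fin.sum_univ_succAbove _ i]

/-- Rank-one matrix determinant lemma, for deleting one observation from the scatter matrix. -/
theorem det_sub_vecMulVec {A : Matrix (Fin d) (Fin d) ℝ} (hA : A.det ≠ 0) (u : Fin d → ℝ) :
    (A - Matrix.vecMulVec u u).det = A.det * (1 - u ⬝ᵥ A⁻¹.mulVec u) := by
  have h := Matrix.det_add_mul (Matrix.replicateCol (Fin 1) (-u)) (Matrix.replicateRow (Fin 1) u)
    (isUnit_iff_ne_zero.2 hA)
  have h1 : Matrix.replicateCol (Fin 1) (-u) * Matrix.replicateRow (Fin 1) u =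
      -Matrix.vecMulVec u u := by
    ext i j
    simp [Matrix.mul_apply, Matrix.vecMulVec_apply]
  rw [h1, ← sub_eq_add_neg] at h
  rw [h, Matrix.det_unique (n := Fin 1), Matrix.add_apply, Matrix.one_apply_eq, sub_eq_add_neg]
  congr 2
  rw [Matrix.mul_assoc, ← Matrix.replicateCol_mulVec,
    Matrix.replicateRow_mul_replicateCol_apply, Matrix.mulVec_neg, dotProduct_neg]

@[fun_prop]
theorem measurable_det_scatter {N : ℕ} :
    Measurable fun x : Fin N → EuclideanSpace ℝ (Fin d) => (scatter x).det := by
  fun_prop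

/-- A kernel vector of a sum of positive semidefinite matrices is a kernel vector of each summand.
-/
theorem det_scatter_succAbove_eq_zero {k : ℕ} {x : Fin (k + 1) → EuclideanSpace ℝ (Fin d)}
    (h : (scatter x).det = 0) (i : Fin (k + 1)) :
    (scatter fun j => x (i.succAbove j)).det = 0 := by
  obtain ⟨v, hv, hxv⟩ := Matrix.exists_mulVec_eq_zero_iff.2 h
  refine Matrix.exists_mulVec_eq_zero_iff.1 ⟨v, hv, ?_⟩
  have hp := posSemidef_scatter fun j => x (i.succAbove j)
  have h1 : 0 ≤ star v ⬝ᵥ (scatter fun j => x (i.succAbove j)).mulVec v :=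
    hp.dotProduct_mulVec_nonneg v
  have h2 : star v ⬝ᵥ (scatter x).mulVec v = 0 := by rw [hxv, dotProduct_zero]
  rw [scatter_succAbove i, Matrix.add_mulVec, dotProduct_add] at h2
  have h3 : 0 ≤ star v ⬝ᵥ (Matrix.vecMulVec (x i).ofLp (x i).ofLp).mulVec v :=
    (Matrix.posSemidef_vecMulVec_self_star (x i).ofLp).dotProduct_mulVec_nonneg v
  exact (hp.dotProduct_mulVec_zero_iff v).1 (by linarith)

/-- Summing the leave-one-out determinants. -/
theorem sum_det_scatter_succAbove {k : ℕ} (x : Fin (k + 1) → EuclideanSpace ℝ (Fin d)) :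
    ∑ i : Fin (k + 1), (scatter fun j => x (i.succAbove j)).det + d * (scatter x).det =
      (k + 1) * (scatter x).det := by
  by_cases h : (scatter x).det = 0
  · simp [h, det_scatter_succAbove_eq_zero h]
  · have e : ∀ i : Fin (k + 1), (scatter fun j => x (i.succAbove j)).det =
        (scatter x).det * (1 - (x i).ofLp ⬝ᵥ (scatter x)⁻¹.mulVec (x i).ofLp) := by
      intro i
      rw [← det_sub_vecMulVec h, ← eq_sub_of_add_eq' (scatter_succAbove i x).symm]
    simp_rw [e]
    -- The leverages `xᵢᵀ S⁻¹ xᵢ` add up to `tr(S⁻¹S) = d`.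
    rw [← Finset.mul_sum, Finset.sum_sub_distrib, ← trace_mul_scatter,
      Matrix.nonsing_inv_mul _ (isUnit_iff_ne_zero.2 h)]
    simp
    ring

theorem measurePreserving_zero_succAbove (k : ℕ) :
    MeasurePreserving (fun (x : Fin (k + 1) → EuclideanSpace ℝ (Fin d)) =>
        (x 0, fun j => x (Fin.succAbove 0 j)))
      (gaussianSample 1 (k + 1))
      ((stdGaussian (EuclideanSpace ℝ (Fin d))).prod (gaussianSample 1 k)) := by
  rw [gaussianSample_one, gaussianSample_one]
  exact measurePreserving_piFinSuccAbove
    (fun _ : Fin (k + 1) => stdGaussian (EuclideanSpace ℝ (Fin d))) 0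

theorem measurePreserving_succAbove (k : ℕ) (i : Fin (k + 1)) :
    MeasurePreserving (fun (x : Fin (k + 1) → EuclideanSpace ℝ (Fin d)) j => x (i.succAbove j))
      (gaussianSample 1 (k + 1)) (gaussianSample 1 k) := by
  rw [gaussianSample_one, gaussianSample_one]
  exact measurePreserving_snd.comp (measurePreserving_piFinSuccAbove
    (fun _ : Fin (k + 1) => stdGaussian (EuclideanSpace ℝ (Fin d))) i)

/-- Recurrence for the mean determinant of a Wishart matrix. -/
theorem detMoment_two_succ (d k : ℕ) :
    (k + 1 : ℝ≥0∞) * detMoment d k 2 + d * detMoment d (k + 1) 2 =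
      (k + 1) * detMoment d (k + 1) 2 := by
  have hm : ∀ N : ℕ, Measurable fun x : Fin N → EuclideanSpace ℝ (Fin d) =>
    ENNReal.ofReal (scatter x).det := fun N => by fun_prop
  have hmi : ∀ i : Fin (k + 1), Measurable fun x : Fin (k + 1) → EuclideanSpace ℝ (Fin d) =>
    ENNReal.ofReal (scatter fun j => x (i.succAbove j)).det := fun i =>
      (hm k).comp (measurePreserving_succAbove k i).measurable
  have h : ∀ i : Fin (k + 1), ∫⁻ x, ENNReal.ofReal (scatter fun j => x (i.succAbove j)).det
      ∂(gaussianSample (1 : Matrix (Fin d) (Fin d) ℝ) (k + 1)) = detMoment d k 2 := by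
    intro i
    rw [detMoment_two]
    exact (measurePreserving_succAbove k i).lintegral_comp (hm k)
  have e1 : (k + 1 : ℝ≥0∞) * detMoment d k 2 = ∫⁻ x, ∑ i : Fin (k + 1),
      ENNReal.ofReal (scatter fun j => x (i.succAbove j)).det
        ∂(gaussianSample (1 : Matrix (Fin d) (Fin d) ℝ) (k + 1)) := by
    rw [lintegral_finsetSum _ fun i _ => hmi i]
    simp [h]
  rw [e1, detMoment_two, ← lintegral_const_mul _ (hm _), ← lintegral_const_mul _ (hm _),
    ← lintegral_add_right _ ((hm _).const_mul _)]
  refine lintegral_congr fun x => ?_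
  have := sum_det_scatter_succAbove x
  have hnn := (posSemidef_scatter x).det_nonneg
  rw [← ENNReal.ofReal_sum_of_nonneg fun i _ => (posSemidef_scatter _).det_nonneg,
    ← ENNReal.ofReal_natCast d, ← ENNReal.ofReal_mul (by positivity),
    ← ENNReal.ofReal_add (Finset.sum_nonneg fun i _ => (posSemidef_scatter _).det_nonneg)
      (by positivity), this, ENNReal.ofReal_mul (by positivity)]
  congr 1
  rw [ENNReal.ofReal_add (by positivity) zero_le_one]
  simp

theorem toReal_detMoment_two_succ {d k : ℕ} (h : d ≤ k) :
    (detMoment d (k + 1) 2).toReal =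
      (k + 1) / (k + 1 - d) * (detMoment d k 2).toReal := by
  have := congrArg ENNReal.toReal (detMoment_two_succ d k)
  have f1 := (detMoment_lt_top d k 2).ne
  have f2 := (detMoment_lt_top d (k + 1) 2).ne
  rw [ENNReal.toReal_add (ENNReal.mul_ne_top (by finiteness) f1)
    (ENNReal.mul_ne_top (by finiteness) f2)] at this
  simp only [ENNReal.toReal_mul, ENNReal.toReal_natCast] at this
  have hk : (k + 1 : ℝ≥0∞).toReal = k + 1 := by
    rw [ENNReal.toReal_add (by finiteness) (by finiteness)]; simp
  rw [hk] at this
  have hd : (d : ℝ) ≤ k := by exact_mod_cast h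
  field_simp
  rw [eq_div_iff (by linarith)]
  linarith

/-- Size-biasing by the determinant adds two degrees of freedom. -/
theorem detMoment_two_mul_lintegral (d j : ℕ) {f : Matrix (Fin d) (Fin d) ℝ → ℝ≥0∞}
    (hf : Measurable f) :
    detMoment d j 2 * ∫⁻ x, f (scatter x) ∂(gaussianSample 1 (j + 2)) =
      ∫⁻ x, ENNReal.ofReal (scatter x).det * f (scatter x) ∂(gaussianSample 1 j) := by
  have h := map_scatter_withDensity d j 2 one_pos
  simp only [sub_self, zero_div, neg_zero, zero_mul, Real.exp_zero, mul_one, Real.sqrt_one,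
    one_pow, inv_one, ENNReal.ofReal_one, one_smul] at h
  have hm : Measurable fun S : Matrix (Fin d) (Fin d) ℝ => ENNReal.ofReal (√S.det ^ 2) := by
    fun_prop
  have hs : ∀ N, Measurable (scatter (d := d) (N := N)) := fun N => continuous_scatter.measurable
  have := congrArg (fun μ => ∫⁻ S, f S ∂μ) h
  simp only [lintegral_smul_measure, smul_eq_mul] at this
  rw [lintegral_withDensity_eq_lintegral_mul _ hm hf, lintegral_map hf (hs _),
    lintegral_map (hm.mul hf) (hs _)] at this
  rw [← this]
  refine lintegral_congr fun x => ?_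
  rw [Pi.mul_apply, Real.sq_sqrt (posSemidef_scatter x).det_nonneg]

/-- The law of `W_{j+2}` is that of `W_j` size-biased by the determinant, which gives no mass to
`det ≤ 0`. The two extra degrees of freedom are the price of this argument. -/
theorem ae_det_scatter_pos {N : ℕ} (h : d + 2 ≤ N) :
    ∀ᵐ x ∂(gaussianSample (1 : Matrix (Fin d) (Fin d) ℝ) N), 0 < (scatter x).det := by
  obtain ⟨j, rfl⟩ : ∃ j, N = j + 2 := ⟨N - 2, by omega⟩
  have hms : MeasurableSet {S : Matrix (Fin d) (Fin d) ℝ | S.det ≤ 0} :=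
    (isClosed_le continuous_id.matrix_det continuous_const).measurableSet
  have := detMoment_two_mul_lintegral d j (f := Set.indicator {S | S.det ≤ 0} 1)
    (measurable_one.indicator hms)
  have h0 : ∀ x : Fin j → EuclideanSpace ℝ (Fin d), ENNReal.ofReal (scatter x).det *
      Set.indicator {S : Matrix (Fin d) (Fin d) ℝ | S.det ≤ 0} 1 (scatter x) = 0 := by
    intro x
    by_cases hx : (scatter x).det ≤ 0
    · rw [ENNReal.ofReal_of_nonpos hx, zero_mul]
    · rw [Set.indicator_of_notMem (by exact hx), mul_zero]
  simp_rw [h0] at this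
  rw [lintegral_zero, mul_eq_zero, or_iff_right (detMoment_pos (by omega) 2).ne',
    lintegral_eq_zero_iff (f := fun x => Set.indicator {S : Matrix (Fin d) (Fin d) ℝ | S.det ≤ 0}
      1 (scatter x)) ((measurable_one.indicator hms).comp continuous_scatter.measurable)] at this
  filter_upwards [this] with x hx
  by_contra hn
  rw [Pi.zero_apply, Set.indicator_of_mem (by exact not_lt.1 hn)] at hx
  exact one_ne_zero hx

/-- The size-biasing weight cancels the reciprocal: `E det W_j · E (1/det W_{j+2}) ≤ 1`. -/
theorem lintegral_inv_det_scatter_lt_top {N : ℕ} (h : d + 2 ≤ N) :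
    ∫⁻ x, (ENNReal.ofReal (scatter x).det)⁻¹
      ∂(gaussianSample (1 : Matrix (Fin d) (Fin d) ℝ) N) < ∞ := by
  obtain ⟨j, rfl⟩ : ∃ j, N = j + 2 := ⟨N - 2, by omega⟩
  have := detMoment_two_mul_lintegral d j (f := fun S => (ENNReal.ofReal S.det)⁻¹) (by fun_prop)
  have hle : ∫⁻ x, ENNReal.ofReal (scatter x).det * (ENNReal.ofReal (scatter x).det)⁻¹
      ∂(gaussianSample (1 : Matrix (Fin d) (Fin d) ℝ) j) ≤ 1 := by
    refine (lintegral_mono fun x => ENNReal.mul_inv_le_one _).trans ?_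
    simp
  rw [← this] at hle
  by_contra hn
  rw [not_lt, top_le_iff] at hn
  rw [hn, ENNReal.mul_top (detMoment_pos (by omega) 2).ne'] at hle
  simp at hle

/-- Domination by `|log D| ≤ D + 1/D`, both of which have finite mean. -/
theorem integrable_log_det_scatter {N : ℕ} (h : d + 2 ≤ N) :
    Integrable (fun x => Real.log (scatter x).det)
      (gaussianSample (1 : Matrix (Fin d) (Fin d) ℝ) N) := by
  have i1 : Integrable (fun x => (scatter x).det)
      (gaussianSample (1 : Matrix (Fin d) (Fin d) ℝ) N) := by
    refine (lintegral_ofReal_ne_top_iff_integrable measurable_det_scatter.aestronglyMeasurable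
      (.of_forall fun x => (posSemidef_scatter x).det_nonneg)).1 ?_
    rw [← detMoment_two]; exact (detMoment_lt_top d N 2).ne
  have i2 : Integrable (fun x => ((scatter x).det)⁻¹)
      (gaussianSample (1 : Matrix (Fin d) (Fin d) ℝ) N) := by
    refine (lintegral_ofReal_ne_top_iff_integrable
      measurable_det_scatter.inv.aestronglyMeasurable (.of_forall fun x => inv_nonneg.2 (posSemidef_scatter x).det_nonneg)).1 ?_
    refine ne_of_eq_of_ne ?_ (lintegral_inv_det_scatter_lt_top h).ne
    refine lintegral_congr_ae ((ae_det_scatter_pos h).mono fun x hx => ?_)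
    exact ENNReal.ofReal_inv_of_pos hx
  refine (i1.add i2).mono' measurable_det_scatter.log.aestronglyMeasurable
    ((ae_det_scatter_pos h).mono fun x hx => ?_)
  rw [Real.norm_eq_abs, abs_le]
  have l1 := Real.log_le_sub_one_of_pos hx
  have l2 := Real.one_sub_inv_le_log_of_pos hx
  have : 0 < ((scatter x).det)⁻¹ := by positivity
  simp only [Pi.add_apply]
  constructor <;> linarith

/-- Mean log-determinant of a standard Wishart matrix. -/
def meanLogDet (d N : ℕ) : ℝ :=
  ∫ x, Real.log (scatter x).det ∂(gaussianSample (1 : Matrix (Fin d) (Fin d) ℝ) N)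

theorem measurable_ofReal_det_vecMulVec_add :
    Measurable fun p : Matrix (Fin d) (Fin d) ℝ × EuclideanSpace ℝ (Fin d) =>
      ENNReal.ofReal (Matrix.vecMulVec p.2.ofLp p.2.ofLp + p.1).det := by
  refine Measurable.ennreal_ofReal (Continuous.measurable (Continuous.matrix_det ?_))
  refine Continuous.add ?_ continuous_fst
  exact Continuous.matrix_vecMulVec (by fun_prop) (by fun_prop)

/-- Integrating out one observation. -/
theorem lintegral_det_scatter_succ {k : ℕ} {w : Matrix (Fin d) (Fin d) ℝ → ℝ≥0∞}
    (hw : Measurable w) :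
    ∫⁻ x : Fin (k + 1) → EuclideanSpace ℝ (Fin d), ENNReal.ofReal (scatter x).det *
        w (scatter fun i => x (Fin.succAbove 0 i)) ∂(gaussianSample 1 (k + 1)) =
      ∫⁻ y, (∫⁻ u, ENNReal.ofReal (Matrix.vecMulVec u.ofLp u.ofLp + scatter y).det
        ∂(stdGaussian (EuclideanSpace ℝ (Fin d)))) * w (scatter y) ∂(gaussianSample 1 k) := by
  have hs : Measurable (scatter (d := d) (N := k)) := continuous_scatter.measurable
  set F : EuclideanSpace ℝ (Fin d) × (Fin k → EuclideanSpace ℝ (Fin d)) → ℝ≥0∞ := fun p =>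
    ENNReal.ofReal (Matrix.vecMulVec p.1.ofLp p.1.ofLp + scatter p.2).det * w (scatter p.2)
    with hFdef
  have hF : Measurable F := by
    have h1 : Measurable fun p : EuclideanSpace ℝ (Fin d) × (Fin k → EuclideanSpace ℝ (Fin d)) =>
        scatter p.2 := hs.comp measurable_snd
    have h2 := measurable_ofReal_det_vecMulVec_add.comp (h1.prodMk measurable_fst)
    exact h2.mul (hw.comp h1)
  have e := (measurePreserving_zero_succAbove k).lintegral_comp hF
  rw [lintegral_prod_symm' _ hF] at e
  refine Eq.trans (lintegral_congr fun x => ?_) (e.trans (lintegral_congr fun y => ?_))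
  · rw [hFdef, scatter_succAbove 0 x]
  · have h3 := measurable_ofReal_det_vecMulVec_add.comp
      (measurable_prodMk_left (x := scatter y) (β := EuclideanSpace ℝ (Fin d)))
    exact lintegral_mul_const (w (scatter y)) h3

/-- Integrating out one observation replaces `det W_{j+3}` by a function `G(W_{j+2})`. Undoing the
size-bias cancels the denominator and leaves `E G(W_j) = E det W_{j+1}`. An inequality suffices and
avoids invertibility of `W_j`, since `a · a⁻¹ ≤ 1` always. -/
theorem detMoment_mul_lintegral_ratio_le (d j : ℕ) :
    detMoment d j 2 * ∫⁻ x : Fin (j + 2 + 1) → EuclideanSpace ℝ (Fin d),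
      ENNReal.ofReal (scatter x).det /
        ENNReal.ofReal (scatter fun i => x (Fin.succAbove 0 i)).det ∂(gaussianSample 1 (j + 2 + 1))
      ≤ detMoment d (j + 1) 2 := by
  set ν := stdGaussian (EuclideanSpace ℝ (Fin d)) with hν
  set G : Matrix (Fin d) (Fin d) ℝ → ℝ≥0∞ := fun S =>
    ∫⁻ u, ENNReal.ofReal (Matrix.vecMulVec u.ofLp u.ofLp + S).det ∂ν with hG
  have hGm : Measurable G := 
    Measurable.lintegral_prod_right' measurable_ofReal_det_vecMulVec_add
  have split : ∀ (k : ℕ) (w : Matrix (Fin d) (Fin d) ℝ → ℝ≥0∞), Measurable w →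
      ∫⁻ x : Fin (k + 1) → EuclideanSpace ℝ (Fin d), ENNReal.ofReal (scatter x).det *
        w (scatter fun i => x (Fin.succAbove 0 i)) ∂(gaussianSample 1 (k + 1)) =
      ∫⁻ y, G (scatter y) * w (scatter y) ∂(gaussianSample 1 k) := by
    intro k w hw
    exact lintegral_det_scatter_succ hw
  have hw : Measurable fun S : Matrix (Fin d) (Fin d) ℝ => (ENNReal.ofReal S.det)⁻¹ := by fun_prop
  simp_rw [div_eq_mul_inv]
  rw [split (j + 2) _ hw, detMoment_two_mul_lintegral d j
    (f := fun S => G S * (ENNReal.ofReal S.det)⁻¹) (hGm.mul hw)]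
  have h1 := split j (fun _ => 1) measurable_const
  simp only [mul_one] at h1
  rw [detMoment_two d (j + 1), h1]
  refine lintegral_mono fun x => ?_
  calc ENNReal.ofReal (scatter x).det * (G (scatter x) * (ENNReal.ofReal (scatter x).det)⁻¹)
      = G (scatter x) *
        (ENNReal.ofReal (scatter x).det * (ENNReal.ofReal (scatter x).det)⁻¹) := by ring
    _ ≤ G (scatter x) := mul_le_of_le_one_right' (ENNReal.mul_inv_le_one _)

/-- Apply `log r ≤ r - 1` to the ratio `r` of consecutive determinants; with `k = j + 2` its mean is
at most `(j+1)/(j+1-d)`. -/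
theorem meanLogDet_succ_sub_le {k : ℕ} (h : d + 2 ≤ k) :
    meanLogDet d (k + 1) - meanLogDet d k ≤ d / (k - 1 - d) := by
  obtain ⟨j, rfl⟩ : ∃ j, k = j + 2 := ⟨k - 2, by omega⟩
  set Γ := gaussianSample (1 : Matrix (Fin d) (Fin d) ℝ) (j + 2 + 1)
  have hmp := measurePreserving_succAbove (d := d) (j + 2) 0
  have hle := detMoment_mul_lintegral_ratio_le d j
  have hD := toReal_detMoment_two_succ (d := d) (k := j) (by omega)
  have hpos : 0 < (detMoment d j 2).toReal :=
    ENNReal.toReal_pos (detMoment_pos (by omega) 2).ne' (detMoment_lt_top d j 2).ne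
  have ae1 : ∀ᵐ x ∂Γ, 0 < (scatter x).det := ae_det_scatter_pos (by omega)
  have ae2 : ∀ᵐ x ∂Γ, 0 < (scatter fun i => x (Fin.succAbove 0 i)).det :=
    hmp.quasiMeasurePreserving.ae (ae_det_scatter_pos h)
  have i1 : Integrable (fun x => Real.log (scatter x).det) Γ :=
    integrable_log_det_scatter (by omega)
  have i2 : Integrable (fun x => Real.log (scatter fun i => x (Fin.succAbove 0 i)).det) Γ :=
    hmp.integrable_comp_of_integrable (integrable_log_det_scatter h)
  have m2 : Measurable fun x : Fin (j + 2 + 1) → EuclideanSpace ℝ (Fin d) =>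
      (scatter fun i => x (Fin.succAbove 0 i)).det := by
    have : Measurable fun y : Fin (j + 2) → EuclideanSpace ℝ (Fin d) => (scatter y).det := by
      fun_prop
    exact this.comp hmp.measurable
  have e2 : meanLogDet d (j + 2) =
      ∫ x, Real.log (scatter fun i => x (Fin.succAbove 0 i)).det ∂Γ := by
    rw [meanLogDet, ← hmp.map_eq, integral_map hmp.measurable.aemeasurable
      measurable_det_scatter.log.aestronglyMeasurable]
  set R : (Fin (j + 2 + 1) → EuclideanSpace ℝ (Fin d)) → ℝ := fun x =>
    (scatter x).det / (scatter fun i => x (Fin.succAbove 0 i)).det with hR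
  have hRm : Measurable R := Measurable.div (by fun_prop) m2
  have hR0 : ∀ x, 0 ≤ R x := fun x =>
    div_nonneg (posSemidef_scatter _).det_nonneg (posSemidef_scatter _).det_nonneg
  have hRl : ∫⁻ x, ENNReal.ofReal (R x) ∂Γ = ∫⁻ x, ENNReal.ofReal (scatter x).det /
        ENNReal.ofReal (scatter fun i => x (Fin.succAbove 0 i)).det ∂Γ :=
    lintegral_congr_ae (ae2.mono fun x hx => ENNReal.ofReal_div_of_pos hx)
  rw [← hRl] at hle
  have hfin : ∫⁻ x, ENNReal.ofReal (R x) ∂Γ ≠ ∞ := by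
    intro htop
    rw [htop, ENNReal.mul_top (detMoment_pos (by omega) 2).ne', top_le_iff] at hle
    exact (detMoment_lt_top d (j + 1) 2).ne hle
  have iR : Integrable R Γ := (lintegral_ofReal_ne_top_iff_integrable
    hRm.aestronglyMeasurable (.of_forall hR0)).1 hfin
  have hRint : ∫ x, R x ∂Γ ≤ (j + 1) / (j + 1 - d) := by
    rw [integral_eq_lintegral_of_nonneg_ae (.of_forall hR0) hRm.aestronglyMeasurable]
    have := ENNReal.toReal_mono (detMoment_lt_top d (j + 1) 2).ne hle
    rw [ENNReal.toReal_mul, hD, mul_comm] at this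
    exact le_of_mul_le_mul_right this hpos
  have hmain : meanLogDet d (j + 2 + 1) - meanLogDet d (j + 2) ≤ ∫ x, (R x - 1) ∂Γ := by
    rw [e2, meanLogDet, ← integral_sub i1 i2]
    refine integral_mono_ae (i1.sub i2) (iR.sub (integrable_const 1)) ?_
    filter_upwards [ae1, ae2] with x h1 h2
    rw [← Real.log_div h1.ne' h2.ne']
    exact Real.log_le_sub_one_of_pos (div_pos h1 h2)
  rw [integral_sub iR (integrable_const 1)] at hmain
  simp only [integral_const, probReal_univ, smul_eq_mul, mul_one] at hmain
  have hd : (d : ℝ) ≤ j := by exact_mod_cast (by omega : d ≤ j)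
  have hlast : ((j : ℝ) + 1) / (j + 1 - d) - 1 = d / (((j + 2 : ℕ) : ℝ) - 1 - d) := by
    push_cast
    rw [show (j : ℝ) + 2 - 1 - d = j + 1 - d by ring]
    have : (j : ℝ) + 1 - d ≠ 0 := by linarith
    field_simp
    ring
  rw [← hlast]
  linarith

end Determinants

/-! ### Total variation between sample covariances. -/

section SampleCovarianceTV

variable {d : ℕ}

@[fun_prop]
theorem measurable_trace_scatter {N : ℕ} :
    Measurable fun x : Fin N → EuclideanSpace ℝ (Fin d) => (scatter x).trace := by
  fun_prop

theorem integrable_trace_scatter (d N : ℕ) : Integrable (fun x => (scatter x).trace)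
    (gaussianSample (1 : Matrix (Fin d) (Fin d) ℝ) N) := by
  have i1 : Integrable (fun x => Real.exp ((scatter x).trace / 4))
      (gaussianSample (1 : Matrix (Fin d) (Fin d) ℝ) N) :=
    (lintegral_ofReal_ne_top_iff_integrable
      (measurable_trace_scatter.div_const 4).exp.aestronglyMeasurable
      (.of_forall fun x => (Real.exp_pos _).le)).1 (lintegral_exp_trace_scatter_lt_top d N).ne
  refine (i1.const_mul 4).mono' measurable_trace_scatter.aestronglyMeasurable
     (.of_forall fun x => ?_)
  have h0 := (posSemidef_scatter x).trace_nonneg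
  rw [Real.norm_of_nonneg h0]
  linarith [Real.add_one_le_exp ((scatter x).trace / 4)]

/-- Only linearity in `N` matters: the value at `N = 1` cancels in the divergence. -/
theorem integral_trace_scatter (d N : ℕ) : ∫ x, (scatter x).trace
    ∂(gaussianSample (1 : Matrix (Fin d) (Fin d) ℝ) N) =
      N * ∫ x, (scatter x).trace ∂(gaussianSample (1 : Matrix (Fin d) (Fin d) ℝ) 1) := by
  have h1 : ∫ x, (scatter x).trace ∂(gaussianSample (1 : Matrix (Fin d) (Fin d) ℝ) 1) =
      ∫ u : EuclideanSpace ℝ (Fin d), u.ofLp ⬝ᵥ u.ofLp ∂(stdGaussian _) := by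
    have hmp := measurePreserving_eval (fun _ : Fin 1 => stdGaussian (EuclideanSpace ℝ (Fin d))) 0
    rw [← hmp.map_eq, integral_map hmp.measurable.aemeasurable (Measurable.aestronglyMeasurable (by
      simp only [dotProduct]; fun_prop)), gaussianSample_one]
    refine integral_congr_ae (.of_forall fun x => ?_)
    have := trace_mul_scatter 1 x
    simpa using this
  have hint : ∀ j : Fin N, Integrable (fun x => (x j).ofLp ⬝ᵥ (x j).ofLp)
      (gaussianSample (1 : Matrix (Fin d) (Fin d) ℝ) N) := by
    intro j
    have hm : Measurable fun x : Fin N → EuclideanSpace ℝ (Fin d) =>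
        (x j).ofLp ⬝ᵥ (x j).ofLp := by simp only [dotProduct]; fun_prop
    refine (integrable_trace_scatter d N).mono' hm.aestronglyMeasurable (.of_forall fun x => ?_)
    have hnn : ∀ i, 0 ≤ (x i).ofLp ⬝ᵥ (x i).ofLp := fun i =>
      Finset.sum_nonneg fun a _ => mul_self_nonneg _
    rw [Real.norm_of_nonneg (hnn j)]
    have := trace_mul_scatter 1 x
    simp only [Matrix.one_mul, Matrix.one_mulVec] at this
    rw [this]
    exact Finset.single_le_sum (f := fun j => (x j).ofLp ⬝ᵥ (x j).ofLp)
      (fun i _ => hnn i) (Finset.mem_univ j)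
  have heval : ∀ j : Fin N, ∫ x, (x j).ofLp ⬝ᵥ (x j).ofLp
      ∂(gaussianSample (1 : Matrix (Fin d) (Fin d) ℝ) N) =
      ∫ u : EuclideanSpace ℝ (Fin d), u.ofLp ⬝ᵥ u.ofLp ∂(stdGaussian _) := by
    intro j
    have hmp := measurePreserving_eval (fun _ : Fin N => stdGaussian (EuclideanSpace ℝ (Fin d))) j
    conv_rhs => rw [← hmp.map_eq]
    rw [integral_map hmp.measurable.aemeasurable (Measurable.aestronglyMeasurable (by
      simp only [dotProduct]; fun_prop)), gaussianSample_one]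
  have e : ∀ x : Fin N → EuclideanSpace ℝ (Fin d),
      (scatter x).trace = ∑ j, (x j).ofLp ⬝ᵥ (x j).ofLp := by
    intro x
    have := trace_mul_scatter 1 x
    simpa using this
  simp_rw [e]
  rw [integral_finsetSum _ fun j _ => hint j]
  simp_rw [heval]
  rw [← h1]
  simp

/-- Telescoping: with `log(1 + 1/k) ≥ 1/(k+1)`, the step at `k = n + m` costs at most `d/(k-1-d) -
d/(k+1) = d(d+2)/((k-1-d)(k+1))`. Here `d + 2 ≤ 3d`, `k - 1 - d ≥ n/2` and `k + 1 ≥ n`, whence the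
constant 6. -/
theorem meanLogDet_sub_le {n : ℕ} (hd : 1 ≤ d) (hn : 4 * d ≤ n) (m : ℕ) :
    meanLogDet d (n + m) - meanLogDet d n - d * Real.log ((n + m) / n) ≤
      6 * m * d ^ 2 / n ^ 2 := by
  have hd1 : (1 : ℝ) ≤ d := by exact_mod_cast hd
  have hn4 : 4 * (d : ℝ) ≤ n := by exact_mod_cast hn
  have hn0 : (0 : ℝ) < n := by linarith
  induction m with
  | zero => simp [div_self hn0.ne']
  | succ m ih =>
    have hm0 : (0 : ℝ) ≤ m := by positivity
    have hstep := meanLogDet_succ_sub_le (d := d) (k := n + m) (by omega)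
    have hlog : Real.log ((n + (m + 1 : ℕ)) / n) =
        Real.log ((n + m) / n) + Real.log ((n + m + 1) / (n + m)) := by
      rw [← Real.log_mul (by positivity) (by positivity)]
      congr 1
      push_cast
      field_simp
      ring
    have hl : 1 - ((n + m + 1) / (n + m) : ℝ)⁻¹ ≤ Real.log ((n + m + 1) / (n + m)) :=
      Real.one_sub_inv_le_log_of_pos (by positivity)
    have hl' : 1 - ((n + m + 1) / (n + m) : ℝ)⁻¹ = 1 / (n + m + 1) := by
      field_simp
      ring
    rw [hl'] at hl
    push_cast at hstep ih
    have hden : (n : ℝ) / 2 ≤ n + m - 1 - d := by linarith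
    have hcmp : (d : ℝ) / (n + m - 1 - d) - d * (1 / (n + m + 1)) ≤ 6 * d ^ 2 / n ^ 2 := by
      have h1 : (0 : ℝ) < n + m - 1 - d := by linarith
      have e : (d : ℝ) / (n + m - 1 - d) - d * (1 / (n + m + 1)) =
          d * (d + 2) / ((n + m - 1 - d) * (n + m + 1)) := by
        field_simp
        ring
      rw [e, div_le_div_iff₀ (by positivity) (by positivity)]
      have h2 : (n : ℝ) ^ 2 ≤ 2 * ((n + m - 1 - d) * (n + m + 1)) := by
        nlinarith
      have h3 : (d : ℝ) * (d + 2) ≤ 3 * d ^ 2 := by nlinarith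
      calc (d : ℝ) * (d + 2) * n ^ 2 ≤ 3 * d ^ 2 * (2 * ((n + m - 1 - d) * (n + m + 1))) := by
            gcongr
        _ = _ := by ring
    have hd_l := mul_le_mul_of_nonneg_left hl (by linarith : (0 : ℝ) ≤ d)
    rw [hlog, ← add_assoc n m 1]
    push_cast
    have : (6 : ℝ) * (m + 1) * d ^ 2 / n ^ 2 = 6 * m * d ^ 2 / n ^ 2 + 6 * d ^ 2 / n ^ 2 := by ring
    rw [this]
    linarith

theorem tvDist_scatter_le {n m : ℕ} (hd : 1 ≤ d) (hm : 1 ≤ m) (hnd : 4 * d ≤ n) :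
    tvDist ((gaussianSample (1 : Matrix (Fin d) (Fin d) ℝ) n).map scatter)
      ((gaussianSample (1 : Matrix (Fin d) (Fin d) ℝ) (n + m)).map
        (fun x => ((n + m : ℝ) / n)⁻¹ • scatter x)) ≤ 2 * m * d / n := by
  have hd1 : (1 : ℝ) ≤ d := by exact_mod_cast hd
  have hm1 : (1 : ℝ) ≤ m := by exact_mod_cast hm
  have hn4 : 4 * (d : ℝ) ≤ n := by exact_mod_cast hnd
  have hn0 : (0 : ℝ) < n := by linarith
  set s : ℝ := (n + m : ℝ) / n with hsdef
  have hs : 0 < s := by positivity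
  set Γ := gaussianSample (1 : Matrix (Fin d) (Fin d) ℝ) n
  set Γ' := gaussianSample (1 : Matrix (Fin d) (Fin d) ℝ) (n + m)
  have hms : Measurable (scatter (d := d) (N := n)) := continuous_scatter.measurable
  have hms' : Measurable (fun x : Fin (n + m) → EuclideanSpace ℝ (Fin d) => s⁻¹ • scatter x) :=
    (continuous_scatter.const_smul s⁻¹).measurable
  set P := Γ.map scatter with hP
  set Q := Γ'.map (fun x => s⁻¹ • scatter x) with hQ
  have : IsProbabilityMeasure P := Measure.isProbabilityMeasure_map hms.aemeasurable
  have hQprob : IsProbabilityMeasure Q := Measure.isProbabilityMeasure_map hms'.aemeasurable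
  set c := detMoment d n m * ENNReal.ofReal (((√s ^ d) ^ (n + m))⁻¹) with hc
  have hcfin : c ≠ ∞ := ENNReal.mul_ne_top (detMoment_lt_top d n m).ne ENNReal.ofReal_ne_top
  have hc0 : c ≠ 0 := mul_ne_zero (detMoment_pos (by omega) m).ne'
    (ENNReal.ofReal_pos.2 (by positivity)).ne'
  have hcr : 0 < c.toReal := ENNReal.toReal_pos hc0 hcfin
  have hdetm : Measurable fun S : Matrix (Fin d) (Fin d) ℝ => S.det :=
    continuous_id.matrix_det.measurable
  have htrm : Measurable fun S : Matrix (Fin d) (Fin d) ℝ => S.trace :=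
    (continuous_id.matrix_trace).measurable
  set g : Matrix (Fin d) (Fin d) ℝ → ℝ := fun S =>
    c.toReal⁻¹ * (√S.det ^ m * Real.exp (-((s - 1) / 2) * S.trace)) with hg
  have hgm : Measurable g := by fun_prop
  have hPQ : P.withDensity (fun S => ENNReal.ofReal (g S)) = Q := by
    have h := map_scatter_withDensity d n m hs
    have e : (fun S => ENNReal.ofReal (g S)) = c⁻¹ • fun S : Matrix (Fin d) (Fin d) ℝ =>
        ENNReal.ofReal (√S.det ^ m * Real.exp (-((s - 1) / 2) * S.trace)) := by
      ext S
      rw [Pi.smul_apply, smul_eq_mul, hg, ENNReal.ofReal_mul (by positivity),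
        ENNReal.ofReal_inv_of_pos hcr, ENNReal.ofReal_toReal hcfin]
    rw [e, withDensity_smul _ (by fun_prop), h, smul_smul, ENNReal.inv_mul_cancel hc0 hcfin,
      one_smul]
  have hdpos : MeasurableSet {S : Matrix (Fin d) (Fin d) ℝ | 0 < S.det} :=
    measurableSet_lt measurable_const hdetm
  have hPdet : ∀ᵐ S ∂P, 0 < S.det := by
    rw [hP, ae_map_iff hms.aemeasurable hdpos]
    exact ae_det_scatter_pos (by omega)
  have hgpos : ∀ᵐ S ∂P, 0 < g S := hPdet.mono fun S hS => by positivity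
  have hlogg : ∀ S, 0 < S.det → Real.log (g S) =
      m / 2 * Real.log S.det - (s - 1) / 2 * S.trace - Real.log c.toReal := by
    intro S hS
    rw [hg, Real.log_mul (by positivity) (by positivity), Real.log_mul (by positivity)
      (Real.exp_pos _).ne', Real.log_exp, Real.log_pow, Real.log_sqrt hS.le, Real.log_inv]
    ring
  have iP : Integrable (fun x => m / 2 * Real.log (scatter x).det -
      (s - 1) / 2 * (scatter x).trace - Real.log c.toReal) Γ :=
    (((integrable_log_det_scatter (by omega)).const_mul _).sub
      ((integrable_trace_scatter d n).const_mul _)).sub (integrable_const _)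
  have hP_ae : (fun x => Real.log (g (scatter x))) =ᵐ[Γ] fun x =>
      m / 2 * Real.log (scatter x).det - (s - 1) / 2 * (scatter x).trace - Real.log c.toReal :=
    (ae_det_scatter_pos (by omega)).mono fun x hx => hlogg _ hx
  have hQ_ae : (fun x => Real.log (g (s⁻¹ • scatter x))) =ᵐ[Γ'] fun x =>
      m / 2 * (Real.log (scatter x).det - d * Real.log s) -
        (s - 1) / 2 * (s⁻¹ * (scatter x).trace) - Real.log c.toReal := by
    refine (ae_det_scatter_pos (by omega)).mono fun x hx => ?_
    have hdet : (s⁻¹ • scatter x).det = s⁻¹ ^ d * (scatter x).det := by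
      rw [Matrix.det_smul, Fintype.card_fin]
    have h := hlogg (s⁻¹ • scatter x) (by rw [hdet]; positivity)
    simp only [h]
    rw [hdet, Matrix.trace_smul, Real.log_mul (by positivity) hx.ne', Real.log_pow, Real.log_inv,
      smul_eq_mul]
    ring
  have iQ : Integrable (fun x => m / 2 * (Real.log (scatter x).det - d * Real.log s) -
        (s - 1) / 2 * (s⁻¹ * (scatter x).trace) - Real.log c.toReal) Γ' :=
    ((((integrable_log_det_scatter (by omega)).sub (integrable_const _)).const_mul _).sub
      (((integrable_trace_scatter d (n + m)).const_mul _).const_mul _)).sub (integrable_const _)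
  have hlm : Measurable fun S => Real.log (g S) := hgm.log
  have IP : Integrable (fun S => Real.log (g S)) P :=
    (integrable_map_measure hlm.aestronglyMeasurable hms.aemeasurable).2 (iP.congr hP_ae.symm)
  have IQ : Integrable (fun S => Real.log (g S)) Q :=
    (integrable_map_measure hlm.aestronglyMeasurable hms'.aemeasurable).2 (iQ.congr hQ_ae.symm)
  set τ := ∫ x, (scatter x).trace ∂(gaussianSample (1 : Matrix (Fin d) (Fin d) ℝ) 1)
  have vP : ∫ S, Real.log (g S) ∂P =
      m / 2 * meanLogDet d n - (s - 1) / 2 * (n * τ) - Real.log c.toReal := by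
    rw [hP, integral_map hms.aemeasurable hlm.aestronglyMeasurable, integral_congr_ae hP_ae,
      integral_sub, integral_sub, integral_const_mul, integral_const_mul, integral_trace_scatter]
    · simp [meanLogDet, Γ, τ]
    · exact (integrable_log_det_scatter (by omega)).const_mul _
    · exact (integrable_trace_scatter d n).const_mul _
    · exact ((integrable_log_det_scatter (by omega)).const_mul _).sub
        ((integrable_trace_scatter d n).const_mul _)
    · exact integrable_const _
  have vQ : ∫ S, Real.log (g S) ∂Q =
      m / 2 * (meanLogDet d (n + m) - d * Real.log s) - (s - 1) / 2 * (n * τ)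
        - Real.log c.toReal := by
    rw [hQ, integral_map hms'.aemeasurable hlm.aestronglyMeasurable, integral_congr_ae hQ_ae,
      integral_sub, integral_sub, integral_const_mul, integral_const_mul, integral_const_mul,
      integral_trace_scatter, integral_sub]
    -- The scale `s = (n+m)/n` equalizes the mean traces, so the trace terms of the two integrals
    -- agree.
    · have hsn : s⁻¹ * ((n + m : ℕ) * τ) = n * τ := by
        rw [hsdef]; push_cast; field_simp
      rw [hsn]
      simp [meanLogDet, Γ']
    · exact integrable_log_det_scatter (by omega)
    · exact integrable_const _
    · exact ((integrable_log_det_scatter (by omega)).sub (integrable_const _)).const_mul _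
    · exact ((integrable_trace_scatter d (n + m)).const_mul _).const_mul _
    · exact (((integrable_log_det_scatter (by omega)).sub (integrable_const _)).const_mul _).sub
        (((integrable_trace_scatter d (n + m)).const_mul _).const_mul _)
    · exact integrable_const _
  have hJ : ∫ S, Real.log (g S) ∂Q - ∫ S, Real.log (g S) ∂P ≤ 3 * (m * d / n : ℝ) ^ 2 := by
    have h := meanLogDet_sub_le hd hnd m
    rw [vP, vQ]
    have h' := mul_le_mul_of_nonneg_left h (by positivity : (0 : ℝ) ≤ m / 2)
    have e : (m : ℝ) / 2 * (6 * m * d ^ 2 / n ^ 2) = 3 * (m * d / n : ℝ) ^ 2 := by ring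
    rw [e] at h'
    linarith
  set b : ℝ := m * d / n with hb
  have hb0 : 0 < b := by positivity
  have hQp : IsProbabilityMeasure (P.withDensity fun S => ENNReal.ofReal (g S)) := by
    rw [hPQ]; exact hQprob
  -- With `a = 1/b` and divergence at most `3b²`, the bound reads `2 · TV ≤ 3b/2 + b`, which is
  -- below `4b`.
  have key := tvDist_withDensity_le P hgm hgpos IP (by rw [hPQ]; exact IQ)
    (a := b⁻¹) (by positivity)
  rw [hPQ] at key
  have h1 : b⁻¹ / 2 * (∫ S, Real.log (g S) ∂Q - ∫ S, Real.log (g S) ∂P) ≤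
      b⁻¹ / 2 * (3 * b ^ 2) := mul_le_mul_of_nonneg_left hJ (by positivity)
  have h2 : b⁻¹ / 2 * (3 * b ^ 2) = 3 / 2 * b := by field_simp
  rw [h2] at h1
  have h3 : 2 * (m : ℝ) * d / n = 2 * b := by rw [hb]; ring
  rw [h3]
  simp only [one_div, inv_inv] at key
  linarith

theorem Measure.eq_of_subsingleton {α : Type*} [MeasurableSpace α] [Subsingleton α]
    (P Q : Measure α) [IsProbabilityMeasure P] [IsProbabilityMeasure Q] : P = Q := by
  ext s _
  rcases Set.eq_empty_or_nonempty s with rfl | ⟨x, hx⟩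
  · simp
  · have : s = Set.univ := Set.eq_univ_of_forall fun y => Subsingleton.elim x y ▸ hx
    simp [this]

/-- Total variation bound for sample covariances of consecutive sample sizes. -/
theorem tvDist_sampleCov_le {n m : ℕ} (h : 4 * max m d ≤ n) (C : Matrix (Fin d) (Fin d) ℝ) :
    tvDist ((gaussianSample C n).map sampleCov) ((gaussianSample C (n + m)).map sampleCov)
      ≤ 2 * (m : ℝ) * (d : ℝ) / (n : ℝ) := by
  have p1 : ∀ N, IsProbabilityMeasure ((gaussianSample C N).map sampleCov) := fun N =>
    Measure.isProbabilityMeasure_map measurable_sampleCov.aemeasurable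
  rcases Nat.eq_zero_or_pos m with rfl | hm
  · simp [tvDist_self]
  rcases Nat.eq_zero_or_pos d with rfl | hd
  · rw [Measure.eq_of_subsingleton ((gaussianSample C n).map sampleCov)
      ((gaussianSample C (n + m)).map sampleCov), tvDist_self]
    simp
  have hn0 : (0 : ℝ) < n := by
    have : 0 < n := by omega
    exact_mod_cast this
  refine le_trans ?_ (tvDist_scatter_le hd hm (by omega))
  set A := CFC.sqrt C
  -- One map produces both sample covariances, since `n⁻¹ s⁻¹ = (n+m)⁻¹`; data processing then
  -- removes `C`.
  set f : Matrix (Fin d) (Fin d) ℝ → Matrix (Fin d) (Fin d) ℝ := fun S =>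
    (n : ℝ)⁻¹ • (A * S * A.transpose) with hf
  have hfm : Measurable f := Continuous.measurable (by fun_prop)
  have hms : Measurable (scatter (d := d) (N := n)) := continuous_scatter.measurable
  have hms' : Measurable (fun x : Fin (n + m) → EuclideanSpace ℝ (Fin d) =>
      ((n + m : ℝ) / n)⁻¹ • scatter x) :=
    (continuous_scatter.const_smul ((n + m : ℝ) / n)⁻¹).measurable
  have e1 : (gaussianSample C n).map sampleCov = ((gaussianSample 1 n).map scatter).map f := by
    rw [gaussianSample_eq_map, Measure.map_map measurable_sampleCov
      (continuous_mulCols _).measurable, Measure.map_map hfm hms]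
    congr 1
    ext1 x
    simp only [Function.comp_apply, sampleCov_eq, scatter_mulCols, hf, A]
  have e2 : (gaussianSample C (n + m)).map sampleCov = ((gaussianSample 1 (n + m)).map
      (fun x => ((n + m : ℝ) / n)⁻¹ • scatter x)).map f := by
    rw [gaussianSample_eq_map, Measure.map_map measurable_sampleCov
      (continuous_mulCols _).measurable, Measure.map_map hfm hms']
    congr 1
    ext1 x
    simp only [Function.comp_apply, sampleCov_eq, scatter_mulCols, hf, A, Matrix.mul_smul,
      Matrix.smul_mul, smul_smul]
    congr 1
    push_cast
    field_simp
  have := Measure.isProbabilityMeasure_map (μ := gaussianSample (1 : Matrix (Fin d) (Fin d) ℝ) n)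
    hms.aemeasurable
  have := Measure.isProbabilityMeasure_map
    (μ := gaussianSample (1 : Matrix (Fin d) (Fin d) ℝ) (n + m)) hms'.aemeasurable
  rw [e1, e2]
  exact tvDist_map_le _ _ hfm

end SampleCovarianceTV

/-! ### Orthonormal completion, polar decomposition, measurability of the square root. -/

section OrthogonalFrames

variable {d N : ℕ}

instance instSecondCountableTopologyRealMatrix :
    SecondCountableTopology (Matrix (Fin d) (Fin N) ℝ) :=
  inferInstanceAs (SecondCountableTopology (Fin d → Fin N → ℝ))

instance instStandardBorelSpaceRealMatrix : StandardBorelSpace (Matrix (Fin d) (Fin N) ℝ) :=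
  inferInstanceAs (StandardBorelSpace (Fin d → Fin N → ℝ))

/-- An orthonormal family of at most `N` rows can be completed to an orthogonal matrix. -/
theorem exists_orthogonal_rows (h : d ≤ N) {f : Fin d → EuclideanSpace ℝ (Fin N)} {s : Set (Fin d)}
    (hf : Orthonormal ℝ (s.domRestrict f)) :
    ∃ V ∈ Matrix.orthogonalGroup (Fin N) ℝ, ∀ i ∈ s, ∀ j, (rectId d N * V) i j = f i j := by
  classical
  -- Only the entries indexed by `s'` are kept by the basis extension; the others are placeholders.
  set v : Fin N → EuclideanSpace ℝ (Fin N) := fun k =>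
    if hk : (k : ℕ) < d then f ⟨k, hk⟩ else 0 with hv
  set s' : Set (Fin N) := Fin.castLE h '' s with hs'
  have hvc : ∀ i : Fin d, v (Fin.castLE h i) = f i := fun i => by simp [hv]
  have hort : Orthonormal ℝ (s'.domRestrict v) := by
    rw [orthonormal_iff_ite] at hf ⊢
    rintro ⟨k, hk⟩ ⟨k', hk'⟩
    obtain ⟨i, hi, hik⟩ := id hk
    obtain ⟨j, hj, hjk⟩ := id hk'
    have hiff : ((⟨k, hk⟩ : s') = ⟨k', hk'⟩) ↔ (⟨i, hi⟩ : s) = ⟨j, hj⟩ := by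
      rw [Subtype.mk.injEq, Subtype.mk.injEq, ← hik, ← hjk]
      exact (Fin.castLE_injective h).eq_iff
    change inner ℝ (v k) (v k') = _
    rw [if_congr hiff rfl rfl, ← hik, ← hjk, hvc, hvc]
    exact hf ⟨i, hi⟩ ⟨j, hj⟩
  obtain ⟨b, hb⟩ := hort.exists_orthonormalBasis_extension_of_card_eq (by simp)
  refine ⟨Matrix.of fun k j => b k j, ?_, ?_⟩
  · rw [Matrix.mem_orthogonalGroup_iff]
    ext k l
    have := (orthonormal_iff_ite.1 b.orthonormal) l k
    rw [PiLp.inner_apply] at this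
    simp only [RCLike.inner_apply, conj_trivial] at this
    simp only [Matrix.mul_apply, Matrix.of_apply, Matrix.transpose_apply, Matrix.one_apply, this]
    simp [eq_comm]
  · intro i hi j
    have h1 : b (Fin.castLE h i) = f i := by rw [hb _ ⟨i, hi, rfl⟩, hvc]
    rw [← h1]
    simp only [Matrix.mul_apply, rectId, Matrix.of_apply]
    rw [Finset.sum_eq_single (Fin.castLE h i)]
    · simp
    · intro k _ hk
      have : (i : ℕ) ≠ k := fun h' => hk (Fin.ext h'.symm)
      simp [this]
    · simp

theorem orthogonal_mul_transpose {V : Matrix (Fin N) (Fin N) ℝ}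
    (hV : V ∈ Matrix.orthogonalGroup (Fin N) ℝ) : V * V.transpose = 1 :=
  (Matrix.mem_orthogonalGroup_iff _ _).1 hV

theorem transpose_mem_orthogonalGroup {V : Matrix (Fin N) (Fin N) ℝ}
    (hV : V ∈ Matrix.orthogonalGroup (Fin N) ℝ) :
    V.transpose ∈ Matrix.orthogonalGroup (Fin N) ℝ := by
  rw [Matrix.mem_orthogonalGroup_iff, Matrix.transpose_transpose]
  exact mul_eq_one_comm.1 (orthogonal_mul_transpose hV)

theorem mul_mem_stiefel {U : Matrix (Fin d) (Fin N) ℝ} (hU : U ∈ stiefel d N)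
    {V : Matrix (Fin N) (Fin N) ℝ} (hV : V ∈ Matrix.orthogonalGroup (Fin N) ℝ) :
    U * V ∈ stiefel d N := by
  change U * V * (U * V).transpose = 1
  rw [Matrix.transpose_mul, Matrix.mul_assoc, ← Matrix.mul_assoc V,
    orthogonal_mul_transpose hV, Matrix.one_mul]
  exact hU

theorem isClosed_stiefel : IsClosed (stiefel d N) :=
  isClosed_eq (continuous_id.matrix_mul continuous_id.matrix_transpose) continuous_const

/-- The orthogonal group acts transitively on the Stiefel set. -/
theorem exists_eq_rectId_mul (h : d ≤ N) {U : Matrix (Fin d) (Fin N) ℝ} (hU : U ∈ stiefel d N) :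
    ∃ W ∈ Matrix.orthogonalGroup (Fin N) ℝ, U = rectId d N * W := by
  have hort : Orthonormal ℝ ((Set.univ : Set (Fin d)).domRestrict
      fun i => (WithLp.toLp 2 (U i) : EuclideanSpace ℝ (Fin N))) := by
    rw [orthonormal_iff_ite]
    rintro ⟨i, -⟩ ⟨j, -⟩
    have := congrFun (congrFun (show U * U.transpose = 1 from hU) j) i
    simp only [Matrix.mul_apply, Matrix.transpose_apply, Matrix.one_apply] at this
    simp only [Set.domRestrict_apply, PiLp.inner_apply, RCLike.inner_apply, conj_trivial,
      Subtype.mk.injEq]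
    rw [this]
    simp [eq_comm]
  obtain ⟨W, hW, h1⟩ := exists_orthogonal_rows h hort
  refine ⟨W, hW, ?_⟩
  ext i j
  rw [h1 i trivial]

theorem transpose_sqrt (A : Matrix (Fin d) (Fin d) ℝ) : (CFC.sqrt A).transpose = CFC.sqrt A := by
  have := (Matrix.nonneg_iff_posSemidef.1 (CFC.sqrt_nonneg A)).isHermitian
  rwa [Matrix.IsHermitian, Matrix.conjTranspose_eq_transpose_of_trivial] at this

theorem sqrt_mul_sqrt_of_posSemidef {A : Matrix (Fin d) (Fin d) ℝ} (hA : A.PosSemidef) :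
    CFC.sqrt A * CFC.sqrt A = A := CFC.sqrt_mul_sqrt_self A hA.nonneg

/-- Polar decomposition of a rectangular, possibly rank deficient, matrix. -/
theorem exists_sqrt_mul_eq (h : d ≤ N) (X : Matrix (Fin d) (Fin N) ℝ) :
    ∃ U ∈ stiefel d N, CFC.sqrt (X * X.transpose) * U = X := by
  have hA : (X * X.transpose).PosSemidef := by
    have := Matrix.posSemidef_self_mul_conjTranspose X
    rwa [Matrix.conjTranspose_eq_transpose_of_trivial] at this
  set A := X * X.transpose with hAdef
  set P : Matrix (Fin d) (Fin d) ℝ := hA.isHermitian.eigenvectorUnitary.1 with hP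
  have hPmem : P ∈ Matrix.orthogonalGroup (Fin d) ℝ := hA.isHermitian.eigenvectorUnitary.2
  have hPP : P * P.transpose = 1 := orthogonal_mul_transpose hPmem
  have hPP' : P.transpose * P = 1 := mul_eq_one_comm.1 hPP
  set l := hA.isHermitian.eigenvalues with hl
  have hl0 : ∀ i, 0 ≤ l i := hA.eigenvalues_nonneg
  have hspec : A = P * Matrix.diagonal l * P.transpose := by
    have := hA.isHermitian.spectral_theorem
    rw [Unitary.conjStarAlgAut_apply, Matrix.star_eq_conjTranspose,
      Matrix.conjTranspose_eq_transpose_of_trivial] at this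
    exact this
  set Y := P.transpose * X with hY
  have hYY : Y * Y.transpose = Matrix.diagonal l := by
    rw [hY, Matrix.transpose_mul, Matrix.transpose_transpose, Matrix.mul_assoc,
      ← Matrix.mul_assoc X, ← hAdef, hspec]
    rw [Matrix.mul_assoc, Matrix.mul_assoc, hPP', Matrix.mul_one, ← Matrix.mul_assoc, hPP',
      Matrix.one_mul]
  have hYent : ∀ i j, ∑ k, Y i k * Y j k = if i = j then l i else 0 := by
    intro i j
    have := congrFun (congrFun hYY i) j
    simpa [Matrix.mul_apply, Matrix.diagonal_apply] using this
  -- In eigencoordinates the rows of `Y` are orthogonal with squared norms `l i`. The nonzero rows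
  -- are normalized; a row with `l i = 0` vanishes, so any completing unit vector serves there.
  set s : Set (Fin d) := {i | l i ≠ 0}
  set f : Fin d → EuclideanSpace ℝ (Fin N) := fun i => WithLp.toLp 2 fun k => (√(l i))⁻¹ * Y i k
    with hf
  have hort : Orthonormal ℝ (s.domRestrict f) := by
    rw [orthonormal_iff_ite]
    rintro ⟨i, hi⟩ ⟨j, hj⟩
    simp only [Set.domRestrict_apply, PiLp.inner_apply, RCLike.inner_apply, conj_trivial,
      Subtype.mk.injEq, hf]
    have e : ∑ k, (√(l j))⁻¹ * Y j k * ((√(l i))⁻¹ * Y i k) =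
        (√(l j))⁻¹ * (√(l i))⁻¹ * ∑ k, Y i k * Y j k := by
      rw [Finset.mul_sum]
      exact Finset.sum_congr rfl fun k _ => by ring
    rw [e, hYent]
    by_cases hij : i = j
    · subst hij
      have : (0 : ℝ) < l i := lt_of_le_of_ne (hl0 i) (Ne.symm hi)
      simp only [if_true]
      rw [← mul_inv, Real.mul_self_sqrt this.le, inv_mul_cancel₀ this.ne']
    · simp [hij]
  obtain ⟨V, hV, hVf⟩ := exists_orthogonal_rows h hort
  have hrect : rectId d N ∈ stiefel d N := rectId_mul_transpose h
  have hDU : Matrix.diagonal (fun i => √(l i)) * (rectId d N * V) = Y := by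
    ext i k
    rw [Matrix.diagonal_mul]
    by_cases hi : l i = 0
    · rw [hi, Real.sqrt_zero, zero_mul]
      have h0 := hYent i i
      rw [if_pos rfl, hi, Finset.sum_eq_zero_iff_of_nonneg fun k _ => mul_self_nonneg _] at h0
      exact (mul_self_eq_zero.1 (h0 k (Finset.mem_univ k))).symm
    · have : (0 : ℝ) < l i := lt_of_le_of_ne (hl0 i) (Ne.symm hi)
      rw [hVf i hi, hf, ← mul_assoc, mul_inv_cancel₀ (Real.sqrt_pos.2 this).ne', one_mul]
  have hsqrt : CFC.sqrt A = P * Matrix.diagonal (fun i => √(l i)) * P.transpose := by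
    refine CFC.sqrt_unique ?_ ?_
    · rw [Matrix.mul_assoc, Matrix.mul_assoc, Matrix.mul_assoc, ← Matrix.mul_assoc P.transpose,
        hPP', Matrix.one_mul, ← Matrix.mul_assoc (Matrix.diagonal _),
        Matrix.diagonal_mul_diagonal, ← Matrix.mul_assoc, hspec]
      simp only [Real.mul_self_sqrt (hl0 _)]
    · have hD : (Matrix.diagonal fun i => √(l i)).PosSemidef :=
        Matrix.PosSemidef.diagonal fun i => Real.sqrt_nonneg _
      have := hD.mul_mul_conjTranspose_same P
      rw [Matrix.conjTranspose_eq_transpose_of_trivial] at this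
      exact this.nonneg
  refine ⟨P * (rectId d N * V), ?_, ?_⟩
  · change P * (rectId d N * V) * (P * (rectId d N * V)).transpose = 1
    rw [Matrix.transpose_mul, Matrix.mul_assoc, ← Matrix.mul_assoc (rectId d N * V),
      show rectId d N * V * (rectId d N * V).transpose = 1 from mul_mem_stiefel hrect hV,
      Matrix.one_mul, hPP]
  · rw [hsqrt, Matrix.mul_assoc, ← Matrix.mul_assoc P.transpose, hPP', Matrix.one_mul,
      Matrix.mul_assoc, hDU, hY, ← Matrix.mul_assoc, hPP, Matrix.one_mul]

theorem isClosed_setOf_posSemidef : IsClosed {B : Matrix (Fin d) (Fin d) ℝ | B.PosSemidef} := by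
  have : {B : Matrix (Fin d) (Fin d) ℝ | B.PosSemidef} = {B | B.conjTranspose = B} ∩
      ⋂ x : Fin d → ℝ, {B | 0 ≤ star x ⬝ᵥ B.mulVec x} := by
    ext B
    simp only [Matrix.posSemidef_iff_dotProduct_mulVec, Set.mem_inter_iff, Set.mem_iInter,
      Set.mem_ofPred_eq, Matrix.IsHermitian]
  rw [this]
  refine (isClosed_eq continuous_id.matrix_conjTranspose continuous_id).inter
    (isClosed_iInter fun x => isClosed_le continuous_const ?_)
  exact continuous_const.dotProduct (continuous_id.matrix_mulVec continuous_const)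

/-- The positive square root is a measurable function of the matrix. -/
theorem measurable_matrix_sqrt :
    Measurable (CFC.sqrt : Matrix (Fin d) (Fin d) ℝ → Matrix (Fin d) (Fin d) ℝ) := by
  have : StandardBorelSpace {B : Matrix (Fin d) (Fin d) ℝ | B.PosSemidef} :=
    isClosed_setOf_posSemidef.measurableSet.standardBorel
  set f : {B : Matrix (Fin d) (Fin d) ℝ | B.PosSemidef} → Matrix (Fin d) (Fin d) ℝ :=
    fun B => B.1 * B.1 with hf
  have hinj : Function.Injective f := by
    intro A B hAB
    have hA : (0 : Matrix (Fin d) (Fin d) ℝ) ≤ A.1 := Matrix.PosSemidef.nonneg A.2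
    have hB : (0 : Matrix (Fin d) (Fin d) ℝ) ≤ B.1 := Matrix.PosSemidef.nonneg B.2
    exact Subtype.ext ((CFC.mul_self_eq_mul_self_iff A.1 B.1 hA hB).1 hAB)
  have hm : Measurable f :=
    (continuous_subtype_val.matrix_mul continuous_subtype_val).measurable
  -- Lusin–Souslin: squaring is an injective Borel map on a standard Borel space, so its inverse,
  -- the square root, is Borel on the range.
  have hemb : MeasurableEmbedding f := hm.measurableEmbedding hinj
  have e : (CFC.sqrt : Matrix (Fin d) (Fin d) ℝ → Matrix (Fin d) (Fin d) ℝ) =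
      Function.extend f Subtype.val fun _ => 0 := by
    ext1 A
    by_cases hA : A.PosSemidef
    · have hs : (CFC.sqrt A).PosSemidef := Matrix.nonneg_iff_posSemidef.1 (CFC.sqrt_nonneg A)
      have h1 : f ⟨CFC.sqrt A, hs⟩ = A := sqrt_mul_sqrt_of_posSemidef hA
      conv_rhs => rw [← h1]
      rw [hinj.extend_apply]
    -- Off the positive semidefinite matrices `CFC.sqrt` takes the value `0`, the default of the
    -- extension.
    · rw [Function.extend_apply', CFC.sqrt, cfcₙ_apply_of_not_predicate]
      · rwa [Matrix.nonneg_iff_posSemidef]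
      · rintro ⟨B, rfl⟩
        refine hA ?_
        have hB : B.1.PosSemidef := B.2
        have := Matrix.posSemidef_conjTranspose_mul_self B.1
        rwa [hB.isHermitian.eq] at this
  rw [e]
  exact hemb.measurable_extend measurable_subtype_coe measurable_const

end OrthogonalFrames

/-! ### Haar measure on the orthogonal group and the invariant law on frames. -/

section UniformStiefel

variable {d N : ℕ}

theorem isCompact_orthogonalGroup (N : ℕ) :
    IsCompact (Matrix.orthogonalGroup (Fin N) ℝ : Set (Matrix (Fin N) (Fin N) ℝ)) := by
  have hcl : IsClosed (Matrix.orthogonalGroup (Fin N) ℝ : Set (Matrix (Fin N) (Fin N) ℝ)) :=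
    isClosed_unitary
  have hbox : IsCompact (Set.univ.pi fun _ : Fin N => Set.univ.pi fun _ : Fin N =>
      Set.Icc (-1 : ℝ) 1) := isCompact_univ_pi fun _ => isCompact_univ_pi fun _ => isCompact_Icc
  refine IsCompact.of_isClosed_subset (s := (Set.univ.pi fun _ : Fin N => Set.univ.pi
    fun _ : Fin N => Set.Icc (-1 : ℝ) 1 : Set (Matrix (Fin N) (Fin N) ℝ))) hbox hcl ?_
  intro V hV i _ j _
  have h : ∑ j, V i j * V i j = 1 := by
    have := congrFun (congrFun (orthogonal_mul_transpose hV) i) i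
    rwa [Matrix.one_apply_eq] at this
  have h1 := Finset.single_le_sum (f := fun j => V i j * V i j)
    (fun j _ => mul_self_nonneg _) (Finset.mem_univ j)
  rw [h] at h1
  constructor <;> nlinarith

/-- Existence of a left-invariant probability measure on the orthogonal group. -/
theorem exists_orthogonal_haar (N : ℕ) : ∃ ρ : Measure (Matrix (Fin N) (Fin N) ℝ),
    IsProbabilityMeasure ρ ∧ (∀ᵐ V ∂ρ, V ∈ Matrix.orthogonalGroup (Fin N) ℝ) ∧
      ∀ W ∈ Matrix.orthogonalGroup (Fin N) ℝ, ρ.map (fun V => W * V) = ρ := by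
  have hcomp : CompactSpace (Matrix.orthogonalGroup (Fin N) ℝ) :=
    isCompact_iff_compactSpace.1 (isCompact_orthogonalGroup N)
  set μ := Measure.haarMeasure (⊤ : TopologicalSpace.PositiveCompacts
    (Matrix.orthogonalGroup (Fin N) ℝ)) with hμ
  have hprob : IsProbabilityMeasure μ := ⟨by
    have := Measure.haarMeasure_self (K₀ := (⊤ : TopologicalSpace.PositiveCompacts
      (Matrix.orthogonalGroup (Fin N) ℝ)))
    simpa using this⟩
  refine ⟨μ.map Subtype.val, Measure.isProbabilityMeasure_map measurable_subtype_coe.aemeasurable,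
    ?_, ?_⟩
  · rw [ae_map_iff (p := fun V => V ∈ Matrix.orthogonalGroup (Fin N) ℝ)
      measurable_subtype_coe.aemeasurable
      (isCompact_orthogonalGroup N).isClosed.measurableSet]
    exact .of_forall fun V => V.2
  · intro W hW
    have hWm : Measurable fun V : Matrix (Fin N) (Fin N) ℝ => W * V :=
      (continuous_const.matrix_mul continuous_id).measurable
    rw [Measure.map_map hWm measurable_subtype_coe]
    have hinv := map_mul_left_eq_self μ (⟨W, hW⟩ : Matrix.orthogonalGroup (Fin N) ℝ)
    conv_rhs => rw [← hinv]
    rw [Measure.map_map measurable_subtype_coe (measurable_const_mul _)]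
    rfl

/-- A left-invariant probability measure on the orthogonal group. -/
def orthogonalHaar (N : ℕ) : Measure (Matrix (Fin N) (Fin N) ℝ) :=
  (exists_orthogonal_haar N).choose

instance (N : ℕ) : IsProbabilityMeasure (orthogonalHaar N) :=
  (exists_orthogonal_haar N).choose_spec.1

theorem ae_mem_orthogonalHaar (N : ℕ) :
    ∀ᵐ V ∂(orthogonalHaar N), V ∈ Matrix.orthogonalGroup (Fin N) ℝ :=
  (exists_orthogonal_haar N).choose_spec.2.1

theorem map_mul_left_orthogonalHaar {W : Matrix (Fin N) (Fin N) ℝ}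
    (hW : W ∈ Matrix.orthogonalGroup (Fin N) ℝ) :
    (orthogonalHaar N).map (fun V => W * V) = orthogonalHaar N :=
  (exists_orthogonal_haar N).choose_spec.2.2 W hW

theorem measurable_mul_left (U : Matrix (Fin d) (Fin N) ℝ) :
    Measurable fun V : Matrix (Fin N) (Fin N) ℝ => U * V :=
  (continuous_const.matrix_mul continuous_id).measurable

theorem measurable_mul_right (V : Matrix (Fin N) (Fin N) ℝ) :
    Measurable fun U : Matrix (Fin d) (Fin N) ℝ => U * V :=
  (continuous_id.matrix_mul continuous_const).measurable

theorem measurable_mul_pair : Measurable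
    fun p : Matrix (Fin d) (Fin N) ℝ × Matrix (Fin N) (Fin N) ℝ => p.1 * p.2 :=
  (continuous_fst.matrix_mul continuous_snd).measurable

/-- The law of the first `d` rows of a random orthogonal matrix. -/
def stiefelLaw (d N : ℕ) : Measure (Matrix (Fin d) (Fin N) ℝ) :=
  (orthogonalHaar N).map fun V => rectId d N * V

instance (d N : ℕ) : IsProbabilityMeasure (stiefelLaw d N) :=
  Measure.isProbabilityMeasure_map (measurable_mul_left _).aemeasurable

theorem ae_mem_stiefelLaw (h : d ≤ N) : ∀ᵐ U ∂(stiefelLaw d N), U ∈ stiefel d N := by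
  rw [stiefelLaw, ae_map_iff (p := fun U => U ∈ stiefel d N)
    (measurable_mul_left _).aemeasurable isClosed_stiefel.measurableSet]
  exact (ae_mem_orthogonalHaar N).mono fun V hV => mul_mem_stiefel (rectId_mul_transpose h) hV

/-- By transitivity `U = [I 0] W`, and left invariance absorbs `W`; the law of `U V` does not see
`U`. -/
theorem map_mul_orthogonalHaar (h : d ≤ N) {U : Matrix (Fin d) (Fin N) ℝ}
    (hU : U ∈ stiefel d N) : (orthogonalHaar N).map (fun V => U * V) = stiefelLaw d N := by
  obtain ⟨W, hW, rfl⟩ := exists_eq_rectId_mul h hU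
  conv_rhs => rw [stiefelLaw, ← map_mul_left_orthogonalHaar hW]
  rw [Measure.map_map (measurable_mul_left _) (measurable_mul_left _)]
  congr 1
  ext1 V
  simp only [Function.comp_apply, Matrix.mul_assoc]

/-- Integrate `f(U V)` over `ν` and Haar measure in both orders: invariance of `ν` yields `∫ f ∂ν`,
transitivity yields the integral against `stiefelLaw`. -/
theorem IsInvariantOnStiefel.eq_stiefelLaw (h : d ≤ N) {ν : Measure (Matrix (Fin d) (Fin N) ℝ)}
    (hν : IsInvariantOnStiefel ν) : ν = stiefelLaw d N := by
  have := hν.isProbabilityMeasure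
  refine Measure.ext_of_lintegral _ fun f hf => ?_
  have h1 : ∫⁻ V, ∫⁻ U, f (U * V) ∂ν ∂(orthogonalHaar N) = ∫⁻ U, f U ∂ν := by
    have : ∀ᵐ V ∂(orthogonalHaar N), ∫⁻ U, f (U * V) ∂ν = ∫⁻ U, f U ∂ν := by
      filter_upwards [ae_mem_orthogonalHaar N] with V hV
      conv_rhs => rw [← hν.invariant V hV]
      rw [lintegral_map hf (measurable_mul_right V)]
    rw [lintegral_congr_ae this]
    simp
  have h2 : ∫⁻ U, ∫⁻ V, f (U * V) ∂(orthogonalHaar N) ∂ν = ∫⁻ U, f U ∂(stiefelLaw d N) := by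
    have : ∀ᵐ U ∂ν, ∫⁻ V, f (U * V) ∂(orthogonalHaar N) = ∫⁻ U, f U ∂(stiefelLaw d N) := by
      have hmem : ∀ᵐ U ∂ν, U ∈ stiefel d N := hν.measure_compl
      filter_upwards [hmem] with U hU
      rw [← map_mul_orthogonalHaar h hU, lintegral_map hf (measurable_mul_left U)]
    rw [lintegral_congr_ae this]
    simp
  rw [← h1, ← h2, lintegral_lintegral_swap]
  exact (hf.comp (measurable_mul_pair.comp measurable_swap)).aemeasurable

theorem IsInvariantOnStiefel.isUniformOnStiefel (h : d ≤ N)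
    {μ : Measure (Matrix (Fin d) (Fin N) ℝ)} (hμ : IsInvariantOnStiefel μ) :
    IsUniformOnStiefel μ :=
  ⟨hμ, fun ν hν => by rw [hν.eq_stiefelLaw h, hμ.eq_stiefelLaw h]⟩

end UniformStiefel

/-! ### Rotation invariance of Gaussian samples. -/

section RotationInvariance

variable {d N : ℕ}

/-- Right multiplication of the data matrix. -/
def mulRows (V : Matrix (Fin N) (Fin N) ℝ) (x : Fin N → EuclideanSpace ℝ (Fin d)) :
    Fin N → EuclideanSpace ℝ (Fin d) :=
  columns (dataMatrix x * V)

@[fun_prop]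
theorem continuous_columns : Continuous (columns (d := d) (N := N)) := by
  unfold columns
  refine continuous_pi fun j => (PiLp.continuous_toLp 2 _).comp (continuous_pi fun i => ?_)
  exact (continuous_apply j).comp (continuous_apply i)

theorem continuous_mulRows (V : Matrix (Fin N) (Fin N) ℝ) :
    Continuous (mulRows (d := d) V) :=
  continuous_columns.comp (continuous_dataMatrix.matrix_mul continuous_const)

@[simp]
theorem dataMatrix_mulRows (V : Matrix (Fin N) (Fin N) ℝ) (x : Fin N → EuclideanSpace ℝ (Fin d)) :
    dataMatrix (mulRows V x) = dataMatrix x * V := rfl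

theorem dataMatrix_injective : Function.Injective (dataMatrix (d := d) (N := N)) :=
  fun x y h => by rw [← columns_dataMatrix x, h, columns_dataMatrix]

theorem mulCols_mulRows (B : Matrix (Fin d) (Fin d) ℝ) (V : Matrix (Fin N) (Fin N) ℝ)
    (x : Fin N → EuclideanSpace ℝ (Fin d)) :
    mulCols B (mulRows V x) = mulRows V (mulCols B x) := by
  apply dataMatrix_injective
  simp only [dataMatrix_mulCols, dataMatrix_mulRows, Matrix.mul_assoc]

theorem scatter_mulRows {V : Matrix (Fin N) (Fin N) ℝ}
    (hV : V ∈ Matrix.orthogonalGroup (Fin N) ℝ) (x : Fin N → EuclideanSpace ℝ (Fin d)) :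
    scatter (mulRows V x) = scatter x := by
  rw [scatter, dataMatrix_mulRows, Matrix.transpose_mul, Matrix.mul_assoc, ← Matrix.mul_assoc V,
    orthogonal_mul_transpose hV, Matrix.one_mul, scatter]

theorem sum_inner_eq_trace (x y : Fin N → EuclideanSpace ℝ (Fin d)) :
    ∑ j, inner ℝ (x j) (y j) = (dataMatrix x * (dataMatrix y).transpose).trace := by
  simp only [PiLp.inner_apply, RCLike.inner_apply, conj_trivial, Matrix.trace, Matrix.diag,
    Matrix.mul_apply, Matrix.transpose_apply, dataMatrix, Matrix.of_apply]
  rw [Finset.sum_comm]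
  exact Finset.sum_congr rfl fun i _ => Finset.sum_congr rfl fun j _ => mul_comm _ _

/-- Characteristic functions: the pairing is a trace, so `V` moves to the argument as `Vᵀ` and
preserves its norm, the only quantity on which the standard Gaussian transform depends. -/
theorem map_mulRows_gaussianSample_one {V : Matrix (Fin N) (Fin N) ℝ}
    (hV : V ∈ Matrix.orthogonalGroup (Fin N) ℝ) :
    (gaussianSample (1 : Matrix (Fin d) (Fin d) ℝ) N).map (mulRows V) = gaussianSample 1 N := by
  have hm := (continuous_mulRows (d := d) V).measurable
  have := Measure.isProbabilityMeasure_map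
    (μ := gaussianSample (1 : Matrix (Fin d) (Fin d) ℝ) N) hm.aemeasurable
  rw [gaussianSample_one] at this ⊢
  refine charFun_eq_pi_iff.1 fun t => ?_
  set t' : PiLp 2 (fun _ : Fin N => EuclideanSpace ℝ (Fin d)) :=
    WithLp.toLp 2 (mulRows V.transpose t.ofLp) with ht'
  have h1 : charFun (((Measure.pi fun _ : Fin N => stdGaussian (EuclideanSpace ℝ (Fin d))).map
      (mulRows V)).map (WithLp.toLp 2)) t =
      charFun ((Measure.pi fun _ : Fin N => stdGaussian (EuclideanSpace ℝ (Fin d))).map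
        (WithLp.toLp 2)) t' := by
    rw [charFun_apply, charFun_apply, Measure.map_map (by fun_prop) hm,
      integral_map (by fun_prop) (by fun_prop), integral_map (by fun_prop) (by fun_prop)]
    refine integral_congr_ae (.of_forall fun x => ?_)
    have e : inner ℝ (WithLp.toLp 2 (mulRows V x) : PiLp 2 fun _ : Fin N =>
        EuclideanSpace ℝ (Fin d)) t = inner ℝ (WithLp.toLp 2 x) t' := by
      rw [PiLp.inner_apply, PiLp.inner_apply]
      have a1 := sum_inner_eq_trace (mulRows V x) t.ofLp
      have a2 := sum_inner_eq_trace x (mulRows V.transpose t.ofLp)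
      rw [dataMatrix_mulRows] at a1 a2
      rw [Matrix.transpose_mul, Matrix.transpose_transpose, ← Matrix.mul_assoc] at a2
      exact a1.trans a2.symm
    simp only [Function.comp_apply, e]
  have h2 : ∑ j, ‖t' j‖ ^ 2 = ∑ j, ‖t j‖ ^ 2 := by
    have a1 := sum_inner_eq_trace t.ofLp t.ofLp
    have a2 := sum_inner_eq_trace t'.ofLp t'.ofLp
    have a3 := scatter_mulRows (transpose_mem_orthogonalGroup hV) t.ofLp
    simp only [real_inner_self_eq_norm_sq] at a1 a2
    rw [a1, a2]
    exact congrArg Matrix.trace a3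
  rw [h1, charFun_pi]
  simp_rw [charFun_stdGaussian, ← Complex.exp_sum, ← Finset.sum_div, Finset.sum_neg_distrib]
  congr 3
  exact_mod_cast h2

/-- The joint law of i.i.d. centered Gaussian vectors is invariant under orthogonal mixing of the
observations. -/
theorem map_mulRows_gaussianSample (C : Matrix (Fin d) (Fin d) ℝ) {V : Matrix (Fin N) (Fin N) ℝ}
    (hV : V ∈ Matrix.orthogonalGroup (Fin N) ℝ) :
    (gaussianSample C N).map (mulRows V) = gaussianSample C N := by
  have hm := (continuous_mulRows (d := d) V).measurable
  have hc := (continuous_mulCols (N := N) (CFC.sqrt C)).measurable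
  rw [gaussianSample_eq_map, Measure.map_map hm hc]
  conv_rhs => rw [← map_mulRows_gaussianSample_one hV, Measure.map_map hc hm]
  congr 1
  ext1 x
  exact (mulCols_mulRows _ _ _).symm

end RotationInvariance

/-! ### Regenerating the sample and the amplification procedure. -/

section Reconstruction

variable {d N : ℕ}

/-- The data set with a given sample covariance and a given Stiefel factor. -/
def reconstruct (p : Matrix (Fin d) (Fin d) ℝ × Matrix (Fin d) (Fin N) ℝ) :
    Fin N → EuclideanSpace ℝ (Fin d) :=
  columns (CFC.sqrt ((N : ℝ) • p.1) * p.2)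

theorem measurable_reconstruct : Measurable (reconstruct (d := d) (N := N)) := by
  have h1 : Measurable fun p : Matrix (Fin d) (Fin d) ℝ × Matrix (Fin d) (Fin N) ℝ =>
      (CFC.sqrt ((N : ℝ) • p.1), p.2) :=
    (measurable_matrix_sqrt.comp ((continuous_fst.const_smul (N : ℝ)).measurable)).prodMk
      measurable_snd
  have h2 : Measurable fun q : Matrix (Fin d) (Fin d) ℝ × Matrix (Fin d) (Fin N) ℝ =>
      q.1 * q.2 := (continuous_fst.matrix_mul continuous_snd).measurable
  exact continuous_columns.measurable.comp (h2.comp h1)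

/-- Given the sample covariance, the sample is recovered by an independent uniform Stiefel
factor. -/
theorem map_reconstruct (h : d ≤ N) (C : Matrix (Fin d) (Fin d) ℝ) :
    (((gaussianSample C N).map sampleCov).prod (stiefelLaw d N)).map reconstruct =
      gaussianSample C N := by
  refine Measure.ext_of_lintegral _ fun f hf => ?_
  have hfr : Measurable fun p : Matrix (Fin d) (Fin d) ℝ × Matrix (Fin d) (Fin N) ℝ =>
    f (reconstruct p) := hf.comp measurable_reconstruct
  rw [lintegral_map hf measurable_reconstruct, lintegral_prod _ hfr.aemeasurable,
    lintegral_map hfr.lintegral_prod_right' measurable_sampleCov]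
  -- For fixed data any polar factor `U` may be used pointwise, with no measurable selection: `U V`
  -- has the uniform law and the reconstruction from `U V` is the data rotated by `V`.
  have key : ∀ x : Fin N → EuclideanSpace ℝ (Fin d),
      ∫⁻ U, f (reconstruct (sampleCov x, U)) ∂(stiefelLaw d N) =
        ∫⁻ V, f (mulRows V x) ∂(orthogonalHaar N) := by
    intro x
    obtain ⟨U, hU, hUx⟩ := exists_sqrt_mul_eq h (dataMatrix x)
    have hfx : Measurable fun U => f (reconstruct (sampleCov x, U)) :=
      hfr.comp measurable_prodMk_left
    rw [← map_mul_orthogonalHaar h hU, lintegral_map hfx (measurable_mul_left U)]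
    refine lintegral_congr fun V => ?_
    congr 1
    rw [reconstruct, natCast_smul_sampleCov, ← Matrix.mul_assoc, scatter, hUx, mulRows]
  simp_rw [key]
  have hpair : Measurable fun p : (Fin N → EuclideanSpace ℝ (Fin d)) × Matrix (Fin N) (Fin N) ℝ =>
      mulRows p.2 p.1 := by
    have h1 : Measurable fun p : (Fin N → EuclideanSpace ℝ (Fin d)) × Matrix (Fin N) (Fin N) ℝ =>
        (dataMatrix p.1, p.2) :=
      (continuous_dataMatrix.measurable.comp measurable_fst).prodMk measurable_snd
    have h2 : Measurable fun q : Matrix (Fin d) (Fin N) ℝ × Matrix (Fin N) (Fin N) ℝ =>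
        q.1 * q.2 := (continuous_fst.matrix_mul continuous_snd).measurable
    exact continuous_columns.measurable.comp (h2.comp h1)
  rw [lintegral_lintegral_swap (f := fun x V => f (mulRows V x)) (hf.comp hpair).aemeasurable]
  have : ∀ᵐ V ∂(orthogonalHaar N), ∫⁻ x, f (mulRows V x) ∂(gaussianSample C N) =
      ∫⁻ x, f x ∂(gaussianSample C N) := by
    filter_upwards [ae_mem_orthogonalHaar N] with V hV
    conv_rhs => rw [← map_mulRows_gaussianSample C hV]
    rw [lintegral_map hf (continuous_mulRows V).measurable]
  rw [lintegral_congr_ae this]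
  simp

/-- The randomized map that attaches a uniform Stiefel factor to a covariance matrix. -/
def reconstructKernel (d N : ℕ) :
    Kernel (Matrix (Fin d) (Fin d) ℝ) (Fin N → EuclideanSpace ℝ (Fin d)) :=
  (Kernel.id ×ₖ Kernel.const _ (stiefelLaw d N)).map reconstruct

instance (d N : ℕ) : IsMarkovKernel (reconstructKernel d N) :=
  Kernel.IsMarkovKernel.map _ measurable_reconstruct

theorem bind_reconstructKernel (μ : Measure (Matrix (Fin d) (Fin d) ℝ)) [SFinite μ] :
    μ.bind (reconstructKernel d N) = (μ.prod (stiefelLaw d N)).map reconstruct := by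
  refine Measure.ext_of_lintegral _ fun f hf => ?_
  have hfr : Measurable fun p : Matrix (Fin d) (Fin d) ℝ × Matrix (Fin d) (Fin N) ℝ =>
    f (reconstruct p) := hf.comp measurable_reconstruct
  rw [Measure.lintegral_bind (Kernel.aemeasurable _) hf.aemeasurable,
    lintegral_map hf measurable_reconstruct, lintegral_prod _ hfr.aemeasurable]
  refine lintegral_congr fun S => ?_
  rw [reconstructKernel, Kernel.lintegral_map _ measurable_reconstruct _ hf,
    Kernel.lintegral_prod _ _ _ hfr]
  simp only [Kernel.id_apply, Kernel.const_apply]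
  rw [lintegral_dirac' _ hfr.lintegral_prod_right']

/-- Output and target both arise from the kernel `reconstructKernel d (n + m)`, fed with the sample
covariance laws at sizes `n` and `n + m`; data processing finishes. -/
theorem admitsSampleAmplification_gaussian {n m : ℕ} (h : 4 * max m d ≤ n) :
    AdmitsSampleAmplification (gaussianCovarianceModel d) n m
      (2 * (m : ℝ) * (d : ℝ) / (n : ℝ)) := by
  refine ⟨(reconstructKernel d (n + m)).comap sampleCov measurable_sampleCov, inferInstance, ?_⟩
  rintro P ⟨C, -, hP⟩
  rw [hP]
  change tvDist ((gaussianSample C n).bind _) (gaussianSample C (n + m)) ≤ _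
  have e1 : (gaussianSample C n).bind
      ((reconstructKernel d (n + m)).comap sampleCov measurable_sampleCov) =
      ((gaussianSample C n).map sampleCov).bind (reconstructKernel d (n + m)) := by
    refine Measure.ext_of_lintegral _ fun f hf => ?_
    rw [Measure.lintegral_bind (Kernel.aemeasurable _) hf.aemeasurable,
      Measure.lintegral_bind (Kernel.aemeasurable _) hf.aemeasurable,
      lintegral_map hf.lintegral_kernel measurable_sampleCov]
    rfl
  have p1 : ∀ N, IsProbabilityMeasure ((gaussianSample C N).map sampleCov) := fun N =>
    Measure.isProbabilityMeasure_map measurable_sampleCov.aemeasurable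
  have e2 : gaussianSample C (n + m) =
      ((gaussianSample C (n + m)).map sampleCov).bind (reconstructKernel d (n + m)) := by
    rw [bind_reconstructKernel, map_reconstruct (by omega)]
  rw [e1]
  conv_lhs => rw [e2]
  exact (tvDist_bind_le _ _ _).trans (tvDist_sampleCov_le h C)

end Reconstruction

/-! ### Uniformity of the normalized data and its randomized version. -/

section NormalizedData

variable {d N : ℕ}

theorem measurable_normalizedData : Measurable (normalizedData (d := d) (N := N)) := by
  have hinv : Measurable fun A : Matrix (Fin d) (Fin d) ℝ => A⁻¹ := by
    simp only [Matrix.inv_def, Ring.inverse_eq_inv']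
    have h1 : Measurable fun A : Matrix (Fin d) (Fin d) ℝ => A.det⁻¹ :=
      (continuous_id.matrix_det.measurable).inv
    have h2 : Measurable fun A : Matrix (Fin d) (Fin d) ℝ => A.adjugate :=
      continuous_id.matrix_adjugate.measurable
    have h3 : Measurable fun p : ℝ × Matrix (Fin d) (Fin d) ℝ => p.1 • p.2 :=
      (continuous_fst.smul continuous_snd).measurable
    exact h3.comp (h1.prodMk h2)
  have h1 : Measurable fun x : Fin N → EuclideanSpace ℝ (Fin d) =>
      (CFC.sqrt ((N : ℝ) • sampleCov x))⁻¹ := by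
    simp_rw [natCast_smul_sampleCov]
    exact hinv.comp (measurable_matrix_sqrt.comp continuous_scatter.measurable)
  have h2 : Measurable fun q : Matrix (Fin d) (Fin d) ℝ × Matrix (Fin d) (Fin N) ℝ =>
      q.1 * q.2 := (continuous_fst.matrix_mul continuous_snd).measurable
  exact h2.comp (h1.prodMk continuous_dataMatrix.measurable)

theorem ae_det_scatter_pos_of_posDef (h : d = 0 ∨ d + 2 ≤ N) {C : Matrix (Fin d) (Fin d) ℝ}
    (hC : C.PosDef) : ∀ᵐ x ∂(gaussianSample C N), 0 < (scatter x).det := by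
  rcases h with rfl | h
  · exact .of_forall fun x => by simp
  have hs : (CFC.sqrt C).det ≠ 0 := by
    intro h0
    have := hC.det_pos
    rw [← sqrt_mul_sqrt_of_posSemidef hC.posSemidef, Matrix.det_mul, h0] at this
    simp at this
  rw [gaussianSample_eq_map, ae_map_iff (continuous_mulCols _).measurable.aemeasurable
    (measurableSet_lt measurable_const measurable_det_scatter)]
  filter_upwards [ae_det_scatter_pos h] with x hx
  rw [scatter_mulCols, Matrix.det_mul, Matrix.det_mul, Matrix.det_transpose]
  have : 0 < (CFC.sqrt C).det * (CFC.sqrt C).det := mul_self_pos.2 hs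
  nlinarith

theorem normalizedData_mem_stiefel {x : Fin N → EuclideanSpace ℝ (Fin d)}
    (hx : 0 < (scatter x).det) : normalizedData x ∈ stiefel d N := by
  change normalizedData x * (normalizedData x).transpose = 1
  rw [normalizedData, natCast_smul_sampleCov]
  set S := CFC.sqrt (scatter x) with hS
  have hSS : S * S = scatter x := sqrt_mul_sqrt_of_posSemidef (posSemidef_scatter x)
  have hdet : IsUnit S.det := by
    rw [isUnit_iff_ne_zero]
    intro h0
    rw [← hSS, Matrix.det_mul, h0] at hx
    simp at hx
  rw [Matrix.transpose_mul, Matrix.transpose_nonsing_inv, transpose_sqrt, ← hS, Matrix.mul_assoc,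
    ← Matrix.mul_assoc (dataMatrix x)]
  change S⁻¹ * (scatter x * S⁻¹) = 1
  rw [← hSS, Matrix.mul_assoc, Matrix.mul_nonsing_inv _ hdet, Matrix.mul_one,
    Matrix.nonsing_inv_mul _ hdet]

theorem normalizedData_mulRows {V : Matrix (Fin N) (Fin N) ℝ}
    (hV : V ∈ Matrix.orthogonalGroup (Fin N) ℝ) (x : Fin N → EuclideanSpace ℝ (Fin d)) :
    normalizedData (mulRows V x) = normalizedData x * V := by
  rw [normalizedData, normalizedData, natCast_smul_sampleCov, natCast_smul_sampleCov,
    scatter_mulRows hV, dataMatrix_mulRows, Matrix.mul_assoc]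

theorem isInvariantOnStiefel_map_normalizedData (h : d = 0 ∨ d + 2 ≤ N)
    {C : Matrix (Fin d) (Fin d) ℝ} (hC : C.PosDef) :
    IsInvariantOnStiefel ((gaussianSample C N).map normalizedData) where
  isProbabilityMeasure :=
    Measure.isProbabilityMeasure_map measurable_normalizedData.aemeasurable
  measure_compl := by
    have : ∀ᵐ U ∂((gaussianSample C N).map normalizedData), U ∈ stiefel d N := by
      rw [ae_map_iff (p := fun U => U ∈ stiefel d N) measurable_normalizedData.aemeasurable
        isClosed_stiefel.measurableSet]
      exact (ae_det_scatter_pos_of_posDef h hC).mono fun x hx => normalizedData_mem_stiefel hx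
    exact this
  invariant := by
    intro V hV
    conv_rhs => rw [← map_mulRows_gaussianSample C hV]
    rw [Measure.map_map (measurable_mul_right V) measurable_normalizedData,
      Measure.map_map measurable_normalizedData (continuous_mulRows V).measurable]
    congr 1
    ext1 x
    exact (normalizedData_mulRows hV x).symm

/-- The construction of `stiefelLaw` uses left invariance only. Right invariance comes from
identifying it with the law of normalized standard Gaussian data. -/
theorem isUniformOnStiefel_stiefelLaw (h : d = 0 ∨ d + 2 ≤ N) :
    IsUniformOnStiefel (stiefelLaw d N) := by
  have hinv := isInvariantOnStiefel_map_normalizedData h Matrix.PosDef.one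
  have hdN : d ≤ N := by omega
  rw [← hinv.eq_stiefelLaw hdN]
  exact hinv.isUniformOnStiefel hdN

/-- Draw a sample covariance and an independent frame, and record the reconstructed sample together
with the frame. The first marginal is the Gaussian sample law, so conditioning the frame on the
sample gives the kernel, and the frame's marginal is uniform by construction. -/
theorem exists_normalizedDataVersion (h : d = 0 ∨ d + 2 ≤ N) (C : Matrix (Fin d) (Fin d) ℝ) :
    ∃ κ : Kernel (Fin N → EuclideanSpace ℝ (Fin d)) (Matrix (Fin d) (Fin N) ℝ),
      IsNormalizedDataVersion C κ ∧ IsUniformOnStiefel ((gaussianSample C N).bind κ) := by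
  have hdN : d ≤ N := by omega
  have p1 : IsProbabilityMeasure ((gaussianSample C N).map sampleCov) :=
    Measure.isProbabilityMeasure_map measurable_sampleCov.aemeasurable
  set M := ((gaussianSample C N).map sampleCov).prod (stiefelLaw d N) with hM
  have hpair : Measurable fun p : Matrix (Fin d) (Fin d) ℝ × Matrix (Fin d) (Fin N) ℝ =>
      (reconstruct p, p.2) := measurable_reconstruct.prodMk measurable_snd
  set J := M.map (fun p => (reconstruct p, p.2)) with hJ
  have pJ : IsProbabilityMeasure J := Measure.isProbabilityMeasure_map hpair.aemeasurable
  have hfst : J.fst = gaussianSample C N := by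
    rw [Measure.fst, hJ, Measure.map_map measurable_fst hpair]
    exact map_reconstruct hdN C
  have hsnd : J.snd = stiefelLaw d N := by
    rw [Measure.snd, hJ, Measure.map_map measurable_snd hpair]
    change M.snd = _
    rw [hM, Measure.snd_prod]
  have hcomp : gaussianSample C N ⊗ₘ J.condKernel = J := by
    have := Measure.disintegrate J J.condKernel
    simp only [hfst] at this
    exact this
  have hMs : ∀ᵐ p ∂M, p.2 ∈ stiefel d N := by
    rw [hM]
    exact Measure.quasiMeasurePreserving_snd.ae (ae_mem_stiefelLaw hdN)
  have hcov : ∀ᵐ S ∂((gaussianSample C N).map sampleCov), ((N : ℝ) • S).PosSemidef := by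
    rw [ae_map_iff (p := fun S => ((N : ℝ) • S).PosSemidef) measurable_sampleCov.aemeasurable
      (isClosed_setOf_posSemidef.preimage (continuous_const_smul (N : ℝ))).measurableSet]
    exact .of_forall fun x => by rw [natCast_smul_sampleCov]; exact posSemidef_scatter x
  have hMp : ∀ᵐ p ∂M, ((N : ℝ) • p.1).PosSemidef := by
    rw [hM]
    exact Measure.quasiMeasurePreserving_fst.ae hcov
  have hmem : ∀ᵐ q ∂J, q.2 ∈ stiefel d N := by
    rw [hJ, ae_map_iff (p := fun q => q.2 ∈ stiefel d N) hpair.aemeasurable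
      (measurable_snd isClosed_stiefel.measurableSet)]
    exact hMs
  have heq : ∀ᵐ q ∂J, CFC.sqrt ((N : ℝ) • sampleCov q.1) * q.2 = dataMatrix q.1 := by
    have hl : Measurable fun q : (Fin N → EuclideanSpace ℝ (Fin d)) × Matrix (Fin d) (Fin N) ℝ =>
        CFC.sqrt ((N : ℝ) • sampleCov q.1) * q.2 := by
      simp_rw [natCast_smul_sampleCov]
      have h1 : Measurable fun q : (Fin N → EuclideanSpace ℝ (Fin d)) × Matrix (Fin d) (Fin N) ℝ =>
          (CFC.sqrt (scatter q.1), q.2) :=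
        (measurable_matrix_sqrt.comp (continuous_scatter.measurable.comp measurable_fst)).prodMk
          measurable_snd
      have h2 : Measurable fun q : Matrix (Fin d) (Fin d) ℝ × Matrix (Fin d) (Fin N) ℝ =>
          q.1 * q.2 := (continuous_fst.matrix_mul continuous_snd).measurable
      exact h2.comp h1
    have hr : Measurable fun q : (Fin N → EuclideanSpace ℝ (Fin d)) × Matrix (Fin d) (Fin N) ℝ =>
        dataMatrix q.1 := continuous_dataMatrix.measurable.comp measurable_fst
    rw [hJ, ae_map_iff (p := fun q => CFC.sqrt ((N : ℝ) • sampleCov q.1) * q.2 = dataMatrix q.1)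
      hpair.aemeasurable (measurableSet_eq_fun hl hr)]
    filter_upwards [hMs, hMp] with p hp hp'
    have hU : p.2 * p.2.transpose = 1 := hp
    have hdm : dataMatrix (reconstruct p) = CFC.sqrt ((N : ℝ) • p.1) * p.2 := rfl
    -- A frame satisfies `U Uᵀ = I`, so reconstruction preserves the prescribed covariance and `U`
    -- is a polar factor of the new data.
    have hsc : scatter (reconstruct p) = (N : ℝ) • p.1 := by
      rw [scatter, hdm, Matrix.transpose_mul, transpose_sqrt, Matrix.mul_assoc,
        ← Matrix.mul_assoc p.2, hU, Matrix.one_mul, sqrt_mul_sqrt_of_posSemidef hp']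
    rw [natCast_smul_sampleCov, hsc, hdm]
  refine ⟨J.condKernel, ⟨inferInstance, ?_, ?_⟩, ?_⟩
  · exact Measure.ae_ae_of_ae_compProd (p := fun q => q.2 ∈ stiefel d N) (by rwa [hcomp])
  · exact Measure.ae_ae_of_ae_compProd
      (p := fun q => CFC.sqrt ((N : ℝ) • sampleCov q.1) * q.2 = dataMatrix q.1) (by rwa [hcomp])
  · rw [← Measure.snd_compProd, hcomp, hsnd]
    exact isUniformOnStiefel_stiefelLaw h

end NormalizedData

end

/-! ### Assembly and the `n/d` rate. -/

section Main

theorem AdmitsSampleAmplification.mono {𝒳 : Type*} [MeasurableSpace 𝒳]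
    {Model : Set (ProbabilityMeasure 𝒳)} {n m : ℕ} {ε δ : ℝ}
    (h : AdmitsSampleAmplification Model n m ε) (hεδ : ε ≤ δ) :
    AdmitsSampleAmplification Model n m δ := by
  obtain ⟨T, hT, h⟩ := h
  exact ⟨T, hT, fun P hP => (h P hP).trans hεδ⟩

theorem admitsSampleAmplification_zero {𝒳 : Type*} [MeasurableSpace 𝒳]
    (Model : Set (ProbabilityMeasure 𝒳)) (n : ℕ) : AdmitsSampleAmplification Model n 0 0 := by
  refine ⟨(Kernel.id : Kernel (Fin n → 𝒳) (Fin n → 𝒳)),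
    inferInstanceAs (IsMarkovKernel (Kernel.id : Kernel (Fin n → 𝒳) (Fin n → 𝒳))),
    fun P _ => ?_⟩
  change tvDist ((Measure.pi fun _ : Fin n => (P : Measure 𝒳)).bind
    (Kernel.id : Kernel (Fin n → 𝒳) (Fin n → 𝒳))) (Measure.pi fun _ : Fin n => (P : Measure 𝒳)) ≤ 0
  rw [Measure.id_comp, tvDist_self]

/-- The constant `1/4` secures the size condition, since `max m d ≤ m d ≤ n/4` for `m ≥ 1`; `ε/2`
makes `2md/n ≤ ε`. For `m = 0` the size condition may fail, and the identity kernel is used. -/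
theorem admitsSampleAmplification_gaussian_of_le {ε : ℝ} (hε : 0 < ε) {d n m : ℕ} (hd : 1 ≤ d)
    (hm : (m : ℝ) ≤ min (1 / 4) (ε / 2) * ((n : ℝ) / (d : ℝ))) :
    AdmitsSampleAmplification (gaussianCovarianceModel d) n m ε := by
  rcases Nat.eq_zero_or_pos m with rfl | hm0
  · exact (admitsSampleAmplification_zero _ n).mono hε.le
  have hd' : (1 : ℝ) ≤ d := by exact_mod_cast hd
  have hd0 : (0 : ℝ) < d := by linarith
  have hmd : (m : ℝ) * d ≤ min (1 / 4) (ε / 2) * n := by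
    rwa [← mul_div_assoc, le_div_iff₀ hd0] at hm
  have h1 : (m : ℝ) * d ≤ 1 / 4 * n :=
    hmd.trans (mul_le_mul_of_nonneg_right (min_le_left _ _) n.cast_nonneg)
  have h2 : (m : ℝ) * d ≤ ε / 2 * n :=
    hmd.trans (mul_le_mul_of_nonneg_right (min_le_right _ _) n.cast_nonneg)
  have h3 : 4 * (m * d) ≤ n := by
    have : 4 * ((m : ℝ) * d) ≤ n := by linarith
    exact_mod_cast this
  have h4 : 4 * max m d ≤ n := by
    have : max m d ≤ m * d :=
      max_le (Nat.le_mul_of_pos_right m hd) (Nat.le_mul_of_pos_left d hm0)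
    omega
  have hn : (0 : ℝ) < n := by
    have : 0 < n := by omega
    exact_mod_cast this
  refine (admitsSampleAmplification_gaussian h4).mono ?_
  rw [div_le_iff₀ hn]
  linarith

end Main

theorem mainTheorem12 :
    (∀ d n m : ℕ, 4 * max m d ≤ n →
      (∀ C : Matrix (Fin d) (Fin d) ℝ, C.PosSemidef →
        tvDist ((gaussianSample C n).map sampleCov) ((gaussianSample C (n + m)).map sampleCov)
          ≤ 2 * (m : ℝ) * (d : ℝ) / (n : ℝ)) ∧
      AdmitsSampleAmplification (gaussianCovarianceModel d) n m
        (2 * (m : ℝ) * (d : ℝ) / (n : ℝ)) ∧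
      (∀ C : Matrix (Fin d) (Fin d) ℝ, C.PosDef →
        IsUniformOnStiefel ((gaussianSample C (n + m)).map normalizedData)) ∧
      (∀ C : Matrix (Fin d) (Fin d) ℝ, C.PosSemidef →
        ∃ κ : Kernel (Fin (n + m) → EuclideanSpace ℝ (Fin d)) (Matrix (Fin d) (Fin (n + m)) ℝ),
          IsNormalizedDataVersion C κ ∧
            IsUniformOnStiefel ((gaussianSample C (n + m)).bind κ))) ∧
    (∀ ε : ℝ, 0 < ε → ∃ c : ℝ, 0 < c ∧ ∀ d n m : ℕ, 1 ≤ d → (m : ℝ) ≤ c * ((n : ℝ) / (d : ℝ)) →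
      AdmitsSampleAmplification (gaussianCovarianceModel d) n m ε) := by
  refine ⟨fun d n m h => ?_, fun ε hε => ?_⟩
  -- For `d ≥ 1` one has `n ≥ 4d ≥ d + 2`; `d = 0` is kept apart because then `n + m` may be less
  -- than 2.
  · have hcond : d = 0 ∨ d + 2 ≤ n + m := by omega
    exact ⟨fun C _ => tvDist_sampleCov_le h C, admitsSampleAmplification_gaussian h,
      fun C hC => (isInvariantOnStiefel_map_normalizedData hcond hC).isUniformOnStiefel (by omega),
      fun C _ => exists_normalizedDataVersion hcond C⟩
  · exact ⟨min (1 / 4) (ε / 2), by positivity, fun d n m hd hm =>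
      admitsSampleAmplification_gaussian_of_le hε hd hm⟩
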